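/- **Setting.** Let $D\subseteq[0,r]^d$ be compact, $r>0$, and let $f$ be a sample path on $D$ of a centred Gaussian process with covariance $k$, where $k(u,v)\le 1$ and $k(u,u)=1$ on $D$. Let $a,b>0$ be such that, for every $L>0$, with probability at least $1-d\,a\,e^{-L^2/b^2}$ the function $f$ is $L$-Lipschitz on $D$ for the 1-norm. Let $\sigma>0$ and let the noise variables $\epsilon_i$ be i.i.d. $\mathcal N(0,\sigma^2)$, independent of $f$. At iteration $i\ge1$ a point $x_i\in D$ is queried and $y_i=f(x_i)+\epsilon_i$ is observed. Let $\mathcal F_{t-1}$ be the $\sigma$-algebra generated by $(x_1,y_1),\dots,(x_{t-1},y_{t-1})$ and let $$\mu_{t-1}(z)=\mathbf k(z)^\top(\mathbf K+\sigma^2\mathbf I)^{-1}\mathbf y,\qquad \sigma_{t-1}^2(z)=k(z,z)-\mathbf k(z)^\top(\mathbf K+\sigma^2\mathbf I)^{-1}\mathbf k(z),$$ with $\mathbf k(z)=(k(x_i,z))_{i<t}$, $\mathbf K=(k(x_i,x_j))_{i,j<t}$, $\mathbf y=(y_i)_{i<t}$. Fix $\delta\in(0,1)$ and put $\pi_t=\pi^2t^2/6$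 and $$\beta_t=2\log(4\pi_t/\delta)+4d\log\bigl(d\,t\,b\,r\sqrt{\log(4da/\delta)}\bigr).$$ GP-UCB, started at iteration $t_0\ge1$ (the points $x_i$ with $i<t_0$ are initial samples), chooses each $x_i$ as an $\mathcal F_{i-1}$-measurable point, and for $i\ge t_0$ the point $x_i$ maximizes $\mu_{i-1}(z)+\beta_i^{1/2}\sigma_{i-1}(z)$ over $z\in D$. Let $r_t=\max_{D}f-f(x_t)$ be the instantaneous regret and $\Phi$ the standard normal distribution function. **Parameters.** Fix $t\ge t_0$, $n_{\eta,t},n_{\alpha,t}>1$, $s_t>0$ and $n_L>1$. Let $\mathbb D_t$ be a discretization of $D$, consisting of $$|\mathbb D_t|=\Bigl\lceil (rdb)^d\,\log(n_Lda/\delta)^{d/2}\,t^{s_td}\Bigr\rceil$$ points of $D$ (repetitions are allowed and counted) such that every point of $D$ is within 1-norm distance $h_t=\bigl(b\sqrt{\log(n_Lda/\delta)}\,t^{s_t}\bigr)^{-1}$ of a point of $\mathbb D_t$. Let $\eta_t,\alpha_t\ge0$ satisfy $$\pi_t\,n_{\eta,t}\bigl(1-\Phi(\eta_t^{1/2})\bigr)=1,\qquad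 \pi_t\,n_{\alpha,t}\,|\mathbb D_t|\bigl(1-\Phi(\alpha_t^{1/2})\bigr)=1,$$ and suppose that $\alpha_t\le\beta_t$. **Claim.** With probability at least $1-\dfrac{\delta}{n_L}-\dfrac1{\pi_t}\Bigl(\dfrac1{n_{\eta,t}}+\dfrac1{n_{\alpha,t}}\Bigr)$, $$r_t\le(\beta_t^{1/2}+\eta_t^{1/2})\,\sigma_{t-1}(x_t)-(\beta_t^{1/2}-\alpha_t^{1/2})\,\sigma\sqrt{\frac1{t+\sigma^2}}+\frac1{t^{s_t}}.$$ -/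

import Mathlib

open MeasureTheory ProbabilityTheory
open scoped Matrix

noncomputable section

namespace GPUCB

/-- The distance of the 1-norm on `ℝ^d`. -/
def dist1 {d : ℕ} (u v : Fin d → ℝ) : ℝ := ∑ i, |u i - v i|

/-- The distribution function `Φ` of the standard normal distribution. -/
def Phi (c : ℝ) : ℝ := cdf (gaussianReal 0 1) c

/-- `P` holds with probability at least `p`: the event contains a measurable event of probability
at least `p`. For a measurable event this says that its probability is at least `p`. -/
def HoldsWithProb {Ω : Type*} [MeasurableSpace Ω] (μ : Measure Ω) (p : ℝ) (P : Ω → Prop) : Prop :=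
  ∃ A : Set Ω, MeasurableSet A ∧ (∀ ω ∈ A, P ω) ∧ p ≤ μ.real A

section Posterior

variable {E : Type*} {n : ℕ}

/-- The regularized kernel matrix `K_n + σ² I` at the sample points `X`. -/
def regGram (k : E → E → ℝ) (σ : ℝ) (X : Fin n → E) : Matrix (Fin n) (Fin n) ℝ :=
  Matrix.of (fun i j => k (X i) (X j)) + (σ ^ 2) • (1 : Matrix (Fin n) (Fin n) ℝ)

/-- The vector `(k(X_1, z), …, k(X_n, z))`. -/
def kvec (k : E → E → ℝ) (X : Fin n → E) (z : E) : Fin n → ℝ := fun i => k (X i) z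

/-- The posterior mean at `z` given the observations `Y` at the points `X`. -/
def postMean (k : E → E → ℝ) (σ : ℝ) (X : Fin n → E) (Y : Fin n → ℝ) (z : E) : ℝ :=
  kvec k X z ⬝ᵥ ((regGram k σ X)⁻¹ *ᵥ Y)

/-- The posterior variance at `z` given observations at the points `X`. -/
def postVar (k : E → E → ℝ) (σ : ℝ) (X : Fin n → E) (z : E) : ℝ :=
  k z z - kvec k X z ⬝ᵥ ((regGram k σ X)⁻¹ *ᵥ kvec k X z)

/-- The posterior standard deviation at `z`. -/
def postStd (k : E → E → ℝ) (σ : ℝ) (X : Fin n → E) (z : E) : ℝ := √(postVar k σ X z)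

end Posterior

/-- The Bayesian setting: `D ⊆ [0,r]^d` is compact, the objective `f` is a sample path on `D` of the
centred Gaussian process with covariance `k`, where `k ≤ 1` and `k(z,z) = 1`; for every `L > 0` the
path is `L`-Lipschitz for the 1-norm with probability at least `1 - d a exp(-L²/b²)`; the noise
`ε` is i.i.d. `N(0,σ²)` and independent of `f`. -/
structure BayesianSetting {d : ℕ} {Ω : Type*} [MeasurableSpace Ω] (μ : Measure Ω)
    (D : Set (Fin d → ℝ)) (r a b σ : ℝ) (k : D → D → ℝ) (f : D → Ω → ℝ) (ε : ℕ → Ω → ℝ) :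
    Prop where
  isCompact : IsCompact D
  subset_cube : D ⊆ Set.Icc 0 (fun _ => r)
  kernel_le_one : ∀ u v, k u v ≤ 1
  kernel_diag : ∀ u, k u u = 1
  measurable_f : ∀ u, Measurable (f u)
  gaussian : IsGaussianProcess f μ
  mean_zero : ∀ u, ∫ ω, f u ω ∂μ = 0
  covariance_eq : ∀ u v, covariance (f u) (f v) μ = k u v
  lipschitz : ∀ L : ℝ, 0 < L →
    HoldsWithProb μ (1 - d * a * Real.exp (-L ^ 2 / b ^ 2))
      (fun ω => ∀ u v : D, |f u ω - f v ω| ≤ L * dist1 (u : Fin d → ℝ) v)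
  measurable_noise : ∀ i, Measurable (ε i)
  noise_law : ∀ i, μ.map (ε i) = gaussianReal 0 (Real.toNNReal (σ ^ 2))
  noise_indep : iIndepFun ε μ
  noise_indep_f : IndepFun (fun ω u => f u ω) (fun ω i => ε i ω) μ

section Algorithm

variable {Ω E : Type*}

/-- The observation `y_i = f(x_i) + ε_i`. -/
def obs (f : E → Ω → ℝ) (ε : ℕ → Ω → ℝ) (x : ℕ → Ω → E) (i : ℕ) (ω : Ω) : ℝ :=
  f (x i ω) ω + ε i ω

/-- The query points `x_1, …, x_{t-1}` made before iteration `t`. -/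
def pastPoints (x : ℕ → Ω → E) (t : ℕ) (ω : Ω) : Fin (t - 1) → E := fun j => x (j + 1) ω

/-- The observations `y_1, …, y_{t-1}` made before iteration `t`. -/
def pastObs (f : E → Ω → ℝ) (ε : ℕ → Ω → ℝ) (x : ℕ → Ω → E) (t : ℕ) (ω : Ω) : Fin (t - 1) → ℝ :=
  fun j => obs f ε x (j + 1) ω

/-- The σ-algebra `F_{t-1}` generated by the history `(x_1, y_1), …, (x_{t-1}, y_{t-1})`. -/
@[reducible] def history [MeasurableSpace E] (f : E → Ω → ℝ) (ε : ℕ → Ω → ℝ) (x : ℕ → Ω → E) (t : ℕ) :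
    MeasurableSpace Ω :=
  MeasurableSpace.comap (fun ω => (pastPoints x t ω, pastObs f ε x t ω)) inferInstance

/-- The posterior mean `μ_{t-1}(z)`. -/
def mu (k : E → E → ℝ) (σ : ℝ) (f : E → Ω → ℝ) (ε : ℕ → Ω → ℝ) (x : ℕ → Ω → E) (t : ℕ) (ω : Ω)
    (z : E) : ℝ :=
  postMean k σ (pastPoints x t ω) (pastObs f ε x t ω) z

/-- The posterior standard deviation `σ_{t-1}(z)`. -/
def sd (k : E → E → ℝ) (σ : ℝ) (x : ℕ → Ω → E) (t : ℕ) (ω : Ω) (z : E) : ℝ :=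
  postStd k σ (pastPoints x t ω) z

/-- The acquisition function `UCB_t(z) = μ_{t-1}(z) + β_t^{1/2} σ_{t-1}(z)`. -/
def ucb (k : E → E → ℝ) (σ : ℝ) (β : ℕ → ℝ) (f : E → Ω → ℝ) (ε : ℕ → Ω → ℝ) (x : ℕ → Ω → E)
    (t : ℕ) (ω : Ω) (z : E) : ℝ :=
  mu k σ f ε x t ω z + √(β t) * sd k σ x t ω z

/-- `x` is a run of GP-UCB with parameters `β` whose acquisition steps start at iteration `t₀`:
each `x_i` is determined by the history before iteration `i`, and from `t₀` on it maximizes the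
acquisition function. The points before `t₀` are the initial samples (none if `t₀ = 1`). -/
structure IsRun [MeasurableSpace E] (k : E → E → ℝ) (σ : ℝ) (β : ℕ → ℝ) (f : E → Ω → ℝ)
    (ε : ℕ → Ω → ℝ) (t₀ : ℕ) (x : ℕ → Ω → E) : Prop where
  adapted : ∀ i, 1 ≤ i → Measurable[history f ε x i] (x i)
  maximizes : ∀ i, t₀ ≤ i → ∀ ω z, ucb k σ β f ε x i ω z ≤ ucb k σ β f ε x i ω (x i ω)

/-- The instantaneous regret `r_t = max f - f(x_t)`. -/
def regret (f : E → Ω → ℝ) (x : ℕ → Ω → E) (t : ℕ) (ω : Ω) : ℝ := (⨆ z, f z ω) - f (x t ω) ω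

end Algorithm

/-- `π_t = π² t² / 6`. -/
def piSeq (t : ℕ) : ℝ := Real.pi ^ 2 * (t : ℝ) ^ 2 / 6

/-- `β_t = 2 log(4 π_t / δ) + 4 d log(d t b r √(log(4 d a / δ)))`. -/
def beta (d : ℕ) (a b r δ : ℝ) (t : ℕ) : ℝ :=
  2 * Real.log (4 * piSeq t / δ) + 4 * d * Real.log (d * t * b * r * √(Real.log (4 * d * a / δ)))

/-- The mesh width `h_t = 1 / (b √(log(n_L d a / δ)) t^s)`. -/
def mesh (d : ℕ) (a b δ nL s : ℝ) (t : ℕ) : ℝ :=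
  1 / (b * √(Real.log (nL * d * a / δ)) * (t : ℝ) ^ s)

/-- The discretization of `D` with parameters `s` and `n_L` at iteration `t`: a list of
`N = ⌈(r d b)^d log(n_L d a / δ)^{d/2} t^{s d}⌉` points of `D` such that every point of `D` is
within 1-norm distance `h_t` of one of them. A set of `N` points is the case without repetitions;
repetitions are allowed so that domains `D` with fewer than `N` points are covered as well. -/
structure IsDiscretization {d : ℕ} {D : Set (Fin d → ℝ)} (a b r δ nL s : ℝ) (t : ℕ)
    {N : ℕ} (𝔻 : Fin N → D) : Prop where
  card_eq : N =
    ⌈(r * d * b) ^ d * Real.log (nL * d * a / δ) ^ ((d : ℝ) / 2) * (t : ℝ) ^ (s * d)⌉₊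
  covers : ∀ u : D, ∃ j, dist1 (u : Fin d → ℝ) (𝔻 j) ≤ mesh d a b δ nL s t

end GPUCB

end

/-! The bound is deterministic on a good event. There `f(u)` is at most `f(𝔻 j) + t^{-s}` for some
`j`, `f` lies below `μ + √α sd` on the discretization, and `f(x_t)` lies above `μ - √η sd`. Writing
`√α = √β - (√β - √α)` turns the upper bound at `𝔻 j` into the acquisition value there minus `(√β -
√α) sd(𝔻 j)`. The maximality of `x_t` and a uniform lower bound on `sd` (`IsUnitKernel.le_postVar`)
then give the claim. The bad event is a union of one Lipschitz failure, one lower tail at `x_t` and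
`N` upper tails; the equations for `η` and `α` are made for this union bound.

The substance is that the Gaussian tails hold exactly although the design is adaptive and `x_t`
depends on the data (`measure_adaptive_residual_gt`). Given the path, the observations have as
density a product of noise densities, and its value at `y` involves the strategy only through the
points that it selects along `y` (`lintegral_obsPath`). So, with `y` frozen, the adaptive likelihood
is that of a fixed design. For a fixed design the posterior residual is jointly Gaussian and
uncorrelated with the observations, hence independent of them, with variance `postVar`. This gives
the conditional tail for almost every `y`; since the design varies with `y`, it is needed for every
`y`, and continuity in `y` supplies this (`lintegral_lik_residual`). Integrating over `y` finishes.

Evaluating a random path at a random point must be measurable, so `f` is replaced by a version with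
continuous paths, which the Lipschitz tails provide. -/

noncomputable section

namespace GPUCB

set_option linter.unusedSectionVars false

/-- A symmetric positive semidefinite kernel with unit diagonal, the positivity being stated for the
quadratic form of the points `X` and one further point `z`. -/
structure IsUnitKernel {E : Type*} (k : E → E → ℝ) : Prop where
  symm : ∀ u v, k u v = k v u
  diag : ∀ u, k u u = 1
  nonneg : ∀ {n : ℕ} (X : Fin n → E) (w : Fin n → ℝ) (z : E) (c : ℝ),
    0 ≤ (∑ i, ∑ j, w i * w j * k (X i) (X j)) + 2 * c * (∑ i, w i * k (X i) z) + c ^ 2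

/-! ### Posterior weights and the lower bound on the posterior variance -/

section Kernel

variable {E : Type*} {k : E → E → ℝ} {σ : ℝ} {n : ℕ}

/-- Cauchy–Schwarz for the kernel: the form at weights `1` and `-k(X i, z)` equals `1 - k(X i, z)²`.
-/
lemma IsUnitKernel.sq_kvec_le_one (hk : IsUnitKernel k) (X : Fin n → E) (z : E) (i : Fin n) :
    kvec k X z i ^ 2 ≤ 1 := by
  have h := hk.nonneg (fun _ : Fin 1 => X i) (fun _ => 1) z (-(k (X i) z))
  simp only [Fin.sum_univ_one, hk.diag] at h
  simp only [kvec]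
  nlinarith

lemma dotProduct_regGram_mulVec (X : Fin n → E) (w : Fin n → ℝ) :
    w ⬝ᵥ (regGram k σ X *ᵥ w) =
      (∑ i, ∑ j, w i * w j * k (X i) (X j)) + σ ^ 2 * ∑ i, w i ^ 2 := by
  simp only [regGram, Matrix.add_mulVec, dotProduct_add, Matrix.smul_mulVec, Matrix.one_mulVec,
    dotProduct_smul, smul_eq_mul]
  congr 1
  · simp only [dotProduct, Matrix.mulVec, Matrix.of_apply, Finset.mul_sum]
    exact Finset.sum_congr rfl fun i _ => Finset.sum_congr rfl fun j _ => by ring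
  · simp only [dotProduct, pow_two]

lemma IsUnitKernel.regGram_transpose (hk : IsUnitKernel k) (X : Fin n → E) :
    (regGram k σ X)ᵀ = regGram k σ X := by
  ext i j
  simp [regGram, Matrix.one_apply, hk.symm (X j) (X i), eq_comm]

/-- The quadratic form dominates `σ² ∑ w_i²`, so the matrix has trivial kernel. -/
lemma IsUnitKernel.isUnit_det_regGram (hk : IsUnitKernel k) (hσ : 0 < σ) (X : Fin n → E) :
    IsUnit (regGram k σ X).det := by
  rw [← Matrix.isUnit_iff_isUnit_det, ← Matrix.mulVec_injective_iff_isUnit]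
  rw [← Matrix.coe_mulVecLin, injective_iff_map_eq_zero]
  intro w hw
  have h1 := dotProduct_regGram_mulVec (k := k) (σ := σ) X w
  rw [Matrix.mulVecLin_apply] at hw
  rw [hw, dotProduct_zero] at h1
  have h3 : 0 ≤ ∑ i, ∑ j, w i * w j * k (X i) (X j) := by
    rcases n with _ | n
    · simp
    · simpa using hk.nonneg X w (X 0) 0
  have h4 : ∑ i, w i ^ 2 ≤ 0 := by
    by_contra! h
    have := mul_pos (pow_pos hσ 2) h
    linarith
  have h5 := (Finset.sum_eq_zero_iff_of_nonneg fun i _ => sq_nonneg (w i)).1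
    (le_antisymm h4 (Finset.sum_nonneg fun i _ => sq_nonneg (w i)))
  ext i
  simpa using h5 i (Finset.mem_univ i)

/-- The weights of the observations in the posterior mean. -/
def postWeights (k : E → E → ℝ) (σ : ℝ) (X : Fin n → E) (z : E) : Fin n → ℝ :=
  (regGram k σ X)⁻¹ *ᵥ kvec k X z

lemma IsUnitKernel.regGram_mulVec_postWeights (hk : IsUnitKernel k) (hσ : 0 < σ) (X : Fin n → E)
    (z : E) : regGram k σ X *ᵥ postWeights k σ X z = kvec k X z := by
  rw [postWeights, Matrix.mulVec_mulVec, Matrix.mul_nonsing_inv _ (hk.isUnit_det_regGram hσ X),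
    Matrix.one_mulVec]

lemma IsUnitKernel.postMean_eq (hk : IsUnitKernel k) (X : Fin n → E) (Y : Fin n → ℝ) (z : E) :
    postMean k σ X Y z = postWeights k σ X z ⬝ᵥ Y := by
  rw [postMean, postWeights, Matrix.dotProduct_mulVec, ← Matrix.mulVec_transpose,
    Matrix.transpose_nonsing_inv, hk.regGram_transpose]

lemma IsUnitKernel.postVar_eq (hk : IsUnitKernel k) (X : Fin n → E) (z : E) :
    postVar k σ X z = 1 - ∑ i, postWeights k σ X z i * k (X i) z := by
  rw [postVar, hk.diag, dotProduct_comm]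
  rfl

/-- The posterior variance is at least `σ² / (n + σ²)`. -/
lemma IsUnitKernel.le_postVar (hk : IsUnitKernel k) (hσ : 0 < σ) (X : Fin n → E) (z : E) :
    σ ^ 2 / (n + σ ^ 2) ≤ postVar k σ X z := by
  set w := postWeights k σ X z with hw
  set l := ∑ i, w i * k (X i) z with hl
  have h1 : l = (∑ i, ∑ j, w i * w j * k (X i) (X j)) + σ ^ 2 * ∑ i, w i ^ 2 := by
    rw [← dotProduct_regGram_mulVec, hk.regGram_mulVec_postWeights hσ]
    rfl
  -- The choice `c = -l` gives `l² ≤ wᵀKw`. With `h1` and Cauchy–Schwarz this yields `(n + σ²) l² ≤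
  -- n l`, so `l ≤ n / (n + σ²)`, while the posterior variance is `1 - l`.
  have h2 := hk.nonneg X w z (-l)
  rw [← hl] at h2
  have h3 : l ^ 2 ≤ n * ∑ i, w i ^ 2 := by
    calc l ^ 2 ≤ (∑ i, w i ^ 2) * ∑ i, (kvec k X z i) ^ 2 :=
          Finset.sum_mul_sq_le_sq_mul_sq _ _ _
      _ ≤ (∑ i, w i ^ 2) * ∑ _i : Fin n, 1 := by
          gcongr with i _
          exact hk.sq_kvec_le_one X z i
      _ = n * ∑ i, w i ^ 2 := by simp [mul_comm]
  have hσ2 : 0 < σ ^ 2 := by positivity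
  have hn : (0 : ℝ) ≤ n := by positivity
  have h4 : l ^ 2 + σ ^ 2 * ∑ i, w i ^ 2 ≤ l := by nlinarith
  have h5 : (n + σ ^ 2) * l ^ 2 ≤ n * l := by nlinarith
  have hl0 : 0 ≤ l := by
    have : 0 ≤ ∑ i, w i ^ 2 := Finset.sum_nonneg fun i _ => sq_nonneg _
    nlinarith [mul_nonneg hσ2.le this, sq_nonneg l]
  rw [hk.postVar_eq, ← hw, ← hl, div_le_iff₀ (by positivity)]
  have h6 : (n + σ ^ 2) * l ≤ n := by
    rcases hl0.eq_or_lt with h | h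
    · rw [← h]; simp
    · nlinarith
  nlinarith

lemma IsUnitKernel.postVar_pos (hk : IsUnitKernel k) (hσ : 0 < σ) (X : Fin n → E) (z : E) :
    0 < postVar k σ X z :=
  lt_of_lt_of_le (by positivity) (hk.le_postVar hσ X z)

end Kernel

/-! ### Measurability of the posterior in the design and the point -/

section Measurability

variable {E T : Type*} [MeasurableSpace E] [MeasurableSpace T] {k : E → E → ℝ} {n : ℕ}

lemma measurable_nonsing_inv_apply {A : T → Matrix (Fin n) (Fin n) ℝ}
    (hA : ∀ i j, Measurable fun s => A s i j) (i j : Fin n) :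
    Measurable fun s => (A s)⁻¹ i j := by
  have hdet : ∀ {B : T → Matrix (Fin n) (Fin n) ℝ}, (∀ i j, Measurable fun s => B s i j) →
      Measurable fun s => (B s).det := fun hB => by
    simp only [Matrix.det_apply]
    exact Finset.measurable_sum _ fun p _ =>
      (Finset.measurable_prod _ fun i _ => hB _ _).const_smul _
  simp only [Matrix.inv_def, Ring.inverse_eq_inv', Matrix.smul_apply, smul_eq_mul,
    Matrix.adjugate_apply]
  refine (hdet hA).inv.mul (hdet fun a b => ?_)
  simp only [Matrix.updateRow_apply]
  split_ifs
  · exact measurable_const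
  · exact hA _ _

lemma measurable_postWeights (hk : Measurable (Function.uncurry k)) {σ : ℝ} {X : T → Fin n → E}
    (hX : Measurable X) {z : T → E} (hz : Measurable z) :
    Measurable fun s => postWeights k σ (X s) (z s) := by
  have hXi : ∀ i, Measurable fun s => X s i := fun i => (measurable_pi_apply i).comp hX
  refine measurable_pi_lambda _ fun i => ?_
  simp only [postWeights, Matrix.mulVec, dotProduct]
  refine Finset.measurable_sum _ fun j _ => Measurable.mul ?_ ?_
  · refine measurable_nonsing_inv_apply (fun a b => ?_) i j
    simp only [regGram, Matrix.add_apply, Matrix.of_apply]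
    exact (hk.comp ((hXi a).prodMk (hXi b))).add measurable_const
  · exact hk.comp ((hXi j).prodMk hz)

lemma IsUnitKernel.measurable_postVar (hu : IsUnitKernel k) (hk : Measurable (Function.uncurry k))
    {σ : ℝ} {X : T → Fin n → E} (hX : Measurable X) {z : T → E} (hz : Measurable z) :
    Measurable fun s => postVar k σ (X s) (z s) := by
  simp only [hu.postVar_eq]
  refine measurable_const.sub (Finset.measurable_sum _ fun i _ => Measurable.mul ?_ ?_)
  · exact (measurable_pi_apply i).comp (measurable_postWeights hk hX hz)
  · exact hk.comp (((measurable_pi_apply i).comp hX).prodMk hz)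

end Measurability

/-! ### Adaptive strategies and their likelihood -/

section Likelihood

variable {E : Type*}

/-- The points queried by the strategy `X`, where `X n` selects a point from `n` observations. -/
def designPts (X : ∀ n, (Fin n → ℝ) → E) (n : ℕ) (y : Fin n → ℝ) : Fin n → E :=
  fun i => X i fun j => y (Fin.castLE i.2.le j)

/-- The observations made by the strategy `X` on the objective `h` with noise `ξ`. -/
def obsPath (X : ∀ n, (Fin n → ℝ) → E) (h : E → ℝ) : ∀ n, (Fin n → ℝ) → (Fin n → ℝ)
  | 0, ξ => ξ
  | n + 1, ξ => Fin.snoc (α := fun _ => ℝ) (obsPath X h n (Fin.init ξ))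
      (h (X n (obsPath X h n (Fin.init ξ))) + ξ (Fin.last n))

/-- The likelihood of the observations `y` at the points `p` for the objective `h` and Gaussian
noise of variance `v`. -/
@[irreducible] def lik (v : NNReal) (h : E → ℝ) {n : ℕ} (p : Fin n → E) (y : Fin n → ℝ) : ENNReal :=
  ∏ i, gaussianPDF 0 v (y i - h (p i))

lemma designPts_snoc_castSucc (X : ∀ n, (Fin n → ℝ) → E) {n : ℕ} (y : Fin n → ℝ) (u : ℝ)
    (i : Fin n) :
    designPts X (n + 1) (Fin.snoc (α := fun _ => ℝ) y u) i.castSucc = designPts X n y i := by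
  simp only [designPts, Fin.val_castSucc]
  congr 1
  ext j
  exact Fin.snoc_castSucc (α := fun _ => ℝ) u y (Fin.castLE i.2.le j)

lemma designPts_snoc_last (X : ∀ n, (Fin n → ℝ) → E) {n : ℕ} (y : Fin n → ℝ) (u : ℝ) :
    designPts X (n + 1) (Fin.snoc (α := fun _ => ℝ) y u) (Fin.last n) = X n y := by
  simp only [designPts, Fin.val_last]
  congr 1
  ext j
  exact Fin.snoc_castSucc (α := fun _ => ℝ) u y j

/-- A new observation leaves the earlier points unchanged, so it contributes just one factor. This
is the induction step for the density of the observations. -/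
lemma lik_designPts_snoc (v : NNReal) (h : E → ℝ) (X : ∀ n, (Fin n → ℝ) → E) {n : ℕ}
    (y : Fin n → ℝ) (u : ℝ) :
    lik v h (designPts X (n + 1) (Fin.snoc (α := fun _ => ℝ) y u)) (Fin.snoc (α := fun _ => ℝ) y u)
      = lik v h (designPts X n y) y * gaussianPDF 0 v (u - h (X n y)) := by
  simp only [lik, Fin.prod_univ_castSucc, designPts_snoc_castSucc, designPts_snoc_last,
    Fin.snoc_castSucc, Fin.snoc_last]

lemma obsPath_eq (X : ∀ n, (Fin n → ℝ) → E) (h : E → ℝ) :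
    ∀ (n : ℕ) (ξ : Fin n → ℝ) (i : Fin n),
      obsPath X h n ξ i = h (designPts X n (obsPath X h n ξ) i) + ξ i
  | 0, _, i => i.elim0
  | n + 1, ξ, i => by
    rw [obsPath]
    refine Fin.lastCases ?_ (fun i => ?_) i
    · rw [designPts_snoc_last, Fin.snoc_last]
    · rw [designPts_snoc_castSucc, Fin.snoc_castSucc, obsPath_eq X h n]
      rfl

lemma lintegral_fin_succ {n : ℕ} {G : (Fin (n + 1) → ℝ) → ENNReal} (hG : Measurable G) :
    ∫⁻ y, G y = ∫⁻ y : Fin n → ℝ, ∫⁻ u : ℝ, G (Fin.snoc (α := fun _ => ℝ) y u) := by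
  have h := (volume_preserving_piFinSuccAbove (fun _ : Fin (n + 1) => ℝ) (Fin.last n)).symm
  rw [← h.lintegral_comp hG, Measure.volume_eq_prod, lintegral_prod_symm']
  · simp [MeasurableEquiv.piFinSuccAbove, Fin.insertNthEquiv]
  · exact hG.comp (MeasurableEquiv.measurable _)

end Likelihood

/-! ### Joint measurability of observations and likelihood -/

section Measurability

variable {S E : Type*} [MeasurableSpace S] [MeasurableSpace E] {e : S → E → ℝ}
  {X : ∀ n, (Fin n → ℝ) → E}

lemma measurable_snoc {n : ℕ} :
    Measurable fun p : (Fin n → ℝ) × ℝ => (Fin.snoc (α := fun _ => ℝ) p.1 p.2 : Fin (n + 1) → ℝ) := by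
  refine measurable_pi_lambda _ fun i => Fin.lastCases ?_ (fun i => ?_) i
  · simpa using measurable_snd
  · simpa only [Fin.snoc_castSucc] using Measurable.fun_comp (measurable_pi_apply i) measurable_fst

lemma measurable_designPts (hX : ∀ n, Measurable (X n)) (n : ℕ) : Measurable (designPts X n) :=
  measurable_pi_lambda _ fun i => (hX i).comp (measurable_pi_lambda _ fun _ => measurable_pi_apply _)

lemma measurable_obsPath (he : Measurable (Function.uncurry e)) (hX : ∀ n, Measurable (X n)) :
    ∀ n, Measurable fun q : S × (Fin n → ℝ) => obsPath X (e q.1) n q.2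
  | 0 => measurable_snd
  | n + 1 => by
    have h1 : Measurable fun q : S × (Fin (n + 1) → ℝ) =>
        obsPath X (e q.1) n (Fin.init (α := fun _ => ℝ) q.2) :=
      (measurable_obsPath he hX n).comp (measurable_fst.prodMk
        (measurable_pi_lambda _ fun i => (measurable_pi_apply _).comp measurable_snd))
    exact measurable_snoc.comp (h1.prodMk ((he.comp (measurable_fst.prodMk ((hX n).comp h1))).add
      ((measurable_pi_apply _).comp measurable_snd)))

lemma measurable_lik (he : Measurable (Function.uncurry e)) (v : NNReal) (n : ℕ) :
    Measurable fun q : S × (Fin n → E) × (Fin n → ℝ) => lik v (e q.1) q.2.1 q.2.2 := by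
  simp only [lik]
  refine Finset.measurable_prod _ fun i _ => ?_
  have h1 : Measurable fun q : S × (Fin n → E) × (Fin n → ℝ) => q.2.2 i :=
    (measurable_pi_apply i).comp (measurable_snd.comp measurable_snd)
  have h2 : Measurable fun q : S × (Fin n → E) × (Fin n → ℝ) => q.2.1 i :=
    (measurable_pi_apply i).comp (measurable_fst.comp measurable_snd)
  have h3 : Measurable fun q : S × (Fin n → E) × (Fin n → ℝ) => e q.1 (q.2.1 i) :=
    he.comp (measurable_fst.prodMk h2)
  exact (measurable_gaussianPDF 0 v).comp (h1.sub h3)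

lemma measurable_lik_designPts (he : Measurable (Function.uncurry e)) (hX : ∀ n, Measurable (X n))
    (v : NNReal) (n : ℕ) :
    Measurable fun q : S × (Fin n → ℝ) => lik v (e q.1) (designPts X n q.2) q.2 := by
  have h : Measurable fun q : S × (Fin n → ℝ) => (q.1, designPts X n q.2, q.2) :=
    measurable_fst.prodMk (((measurable_designPts hX n).comp measurable_snd).prodMk measurable_snd)
  exact (measurable_lik he v n).comp h

end Measurability

/-! ### The density of adaptively collected observations -/

section Observation

variable {S E Ω : Type*} [MeasurableSpace S] [MeasurableSpace E] [MeasurableSpace Ω]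

/-- A random objective `e (F ·)` with path space `S`, observed with i.i.d. Gaussian noise `ξ` of
variance `v` which is independent of `F`. -/
structure IsObservationModel (μ : Measure Ω) (e : S → E → ℝ) (F : Ω → S) (ξ : ℕ → Ω → ℝ)
    (v : NNReal) : Prop where
  measurable_eval : Measurable (Function.uncurry e)
  measurable_path : Measurable F
  measurable_noise : ∀ n, Measurable (ξ n)
  var_ne_zero : v ≠ 0
  noise_law : ∀ n, μ.map (ξ n) = gaussianReal 0 v
  noise_indep : iIndepFun ξ μ
  path_indep : IndepFun F (fun ω n => ξ n ω) μ

variable {μ : Measure Ω} [IsProbabilityMeasure μ] {e : S → E → ℝ} {F : Ω → S} {ξ : ℕ → Ω → ℝ}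
  {v : NNReal} {X : ∀ n, (Fin n → ℝ) → E}

/-- The law of `(f, (g, h))` is a triple product measure; reassociating it isolates `h`. -/
lemma indepFun_prodMk_left {α β γ : Type*} [MeasurableSpace α] [MeasurableSpace β]
    [MeasurableSpace γ] {f : Ω → α} {g : Ω → β} {h : Ω → γ} (hf : Measurable f) (hg : Measurable g)
    (hh : Measurable h) (hfgh : IndepFun f (fun ω => (g ω, h ω)) μ) (hgh : IndepFun g h μ) :
    IndepFun (fun ω => (f ω, g ω)) h μ := by
  have h1 := (indepFun_iff_map_prod_eq_prod_map_map hf.aemeasurable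
    (hg.prodMk hh).aemeasurable).1 hfgh
  have h2 := (indepFun_iff_map_prod_eq_prod_map_map hg.aemeasurable hh.aemeasurable).1 hgh
  have hfg : IndepFun f g μ := hfgh.comp measurable_id measurable_fst
  have h3 := (indepFun_iff_map_prod_eq_prod_map_map hf.aemeasurable hg.aemeasurable).1 hfg
  rw [indepFun_iff_map_prod_eq_prod_map_map (hf.prodMk hg).aemeasurable hh.aemeasurable, h3]
  have := Measure.isProbabilityMeasure_map (μ := μ) hf.aemeasurable
  have := Measure.isProbabilityMeasure_map (μ := μ) hg.aemeasurable
  have := Measure.isProbabilityMeasure_map (μ := μ) hh.aemeasurable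
  refine (MeasurableEquiv.map_measurableEquiv_injective (MeasurableEquiv.prodAssoc)) ?_
  rw [Measure.prodAssoc_prod, ← h2, ← h1,
    Measure.map_map (MeasurableEquiv.measurable _) ((hf.prodMk hg).prodMk hh)]
  rfl

lemma IsObservationModel.indep (hM : IsObservationModel μ e F ξ v) (n : ℕ) :
    IndepFun (fun ω => (F ω, fun j : Fin n => ξ j ω)) (ξ n) μ := by
  refine indepFun_prodMk_left hM.measurable_path
    (measurable_pi_lambda _ fun j => hM.measurable_noise j) (hM.measurable_noise n) ?_ ?_
  · exact hM.path_indep.comp measurable_id (φ := id)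
      (ψ := fun x : ℕ → ℝ => ((fun j : Fin n => x j), x n))
      ((measurable_pi_lambda _ fun j => measurable_pi_apply _).prodMk (measurable_pi_apply n))
  · have h := hM.noise_indep.indepFun_finset (Finset.range n) {n} (by simp) hM.measurable_noise
    exact h.comp (φ := fun x (j : Fin n) => x ⟨j, Finset.mem_range.2 j.2⟩)
      (ψ := fun x : ({n} : Finset ℕ) → ℝ => x ⟨n, Finset.mem_singleton_self n⟩)
      (measurable_pi_lambda _ fun j => measurable_pi_apply _)
      (measurable_pi_apply (X := fun _ : ({n} : Finset ℕ) => ℝ) ⟨n, Finset.mem_singleton_self n⟩)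

/-- Given the objective, the observations of an adaptive strategy have the density `lik`. -/
theorem IsObservationModel.lintegral_obsPath (hM : IsObservationModel μ e F ξ v)
    (hX : ∀ n, Measurable (X n)) :
    ∀ (n : ℕ) (Ψ : S × (Fin n → ℝ) → ENNReal), Measurable Ψ →
      ∫⁻ ω, Ψ (F ω, obsPath X (e (F ω)) n fun j => ξ j ω) ∂μ =
        ∫⁻ ω, (∫⁻ y, lik v (e (F ω)) (designPts X n y) y * Ψ (F ω, y)) ∂μ := by
  intro n
  induction n with
  | zero =>
    intro Ψ _
    refine lintegral_congr fun ω => ?_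
    rw [lintegral_unique]
    simp only [lik, Finset.univ_eq_empty, Finset.prod_empty, one_mul]
    rw [volume_pi, Measure.pi_of_empty (x := default)]
    simp only [measure_univ, mul_one]
    congr 2
    exact Subsingleton.elim _ _
  | succ n ih =>
    intro Ψ hΨ
    have he := hM.measurable_eval
    set Ψ' : S × (Fin n → ℝ) → ENNReal := fun q =>
      ∫⁻ u, gaussianPDF 0 v (u - e q.1 (X n q.2)) * Ψ (q.1, Fin.snoc (α := fun _ => ℝ) q.2 u) with hΨ'
    have heX : Measurable fun q : S × (Fin n → ℝ) => e q.1 (X n q.2) :=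
      he.comp (measurable_fst.prodMk ((hX n).comp measurable_snd))
    have hsn : Measurable fun p : (S × (Fin n → ℝ)) × ℝ =>
        Ψ (p.1.1, Fin.snoc (α := fun _ => ℝ) p.1.2 p.2) :=
      hΨ.comp ((measurable_fst.comp measurable_fst).prodMk (measurable_snoc.comp
        ((measurable_snd.comp measurable_fst).prodMk measurable_snd)))
    have hint : Measurable fun p : (S × (Fin n → ℝ)) × ℝ =>
        gaussianPDF 0 v (p.2 - e p.1.1 (X n p.1.2)) *
          Ψ (p.1.1, Fin.snoc (α := fun _ => ℝ) p.1.2 p.2) :=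
      ((measurable_gaussianPDF 0 v).comp (measurable_snd.sub (heX.comp measurable_fst))).mul hsn
    have hΨ'm : Measurable Ψ' := hint.lintegral_prod_right'
    set Y : Ω → Fin n → ℝ := fun ω => obsPath X (e (F ω)) n fun j => ξ j ω with hY
    have hξn : Measurable fun ω => (F ω, fun j : Fin n => ξ j ω) :=
      hM.measurable_path.prodMk (measurable_pi_lambda _ fun j => hM.measurable_noise j)
    -- The last noise variable is independent of the path and the earlier noise, so it is integrated
    -- out first. Translating it by the value of the objective at the queried point turns it into
    -- the last observation.
    have hstep : ∫⁻ ω, Ψ (F ω, obsPath X (e (F ω)) (n + 1) fun j => ξ j ω) ∂μ =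
        ∫⁻ ω, Ψ' (F ω, Y ω) ∂μ := by
      set Θ : (S × (Fin n → ℝ)) × ℝ → ENNReal := fun p =>
        Ψ (p.1.1, Fin.snoc (α := fun _ => ℝ) (obsPath X (e p.1.1) n p.1.2)
          (e p.1.1 (X n (obsPath X (e p.1.1) n p.1.2)) + p.2)) with hΘ
      have hob := measurable_obsPath (X := X) he hX n
      have hΘm : Measurable Θ := by
        refine hΨ.comp ((measurable_fst.comp measurable_fst).prodMk (measurable_snoc.comp
          ((hob.comp measurable_fst).prodMk (Measurable.add ?_ measurable_snd))))
        exact he.comp ((measurable_fst.comp measurable_fst).prodMk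
          ((hX n).comp (hob.comp measurable_fst)))
      calc ∫⁻ ω, Ψ (F ω, obsPath X (e (F ω)) (n + 1) fun j => ξ j ω) ∂μ
          = ∫⁻ ω, Θ ((F ω, fun j : Fin n => ξ j ω), ξ n ω) ∂μ := rfl
        _ = ∫⁻ p, Θ p ∂(μ.map fun ω => ((F ω, fun j : Fin n => ξ j ω), ξ n ω)) :=
            (lintegral_map hΘm (hξn.prodMk (hM.measurable_noise n))).symm
        _ = ∫⁻ q, ∫⁻ u, Θ (q, u) ∂(gaussianReal 0 v)
              ∂(μ.map fun ω => (F ω, fun j : Fin n => ξ j ω)) := by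
            rw [(indepFun_iff_map_prod_eq_prod_map_map hξn.aemeasurable
              (hM.measurable_noise n).aemeasurable).1 (hM.indep n), hM.noise_law,
              lintegral_prod _ hΘm.aemeasurable]
        _ = ∫⁻ ω, ∫⁻ u, Θ ((F ω, fun j : Fin n => ξ j ω), u) ∂(gaussianReal 0 v) ∂μ :=
            lintegral_map hΘm.lintegral_prod_right' hξn
        _ = ∫⁻ ω, Ψ' (F ω, Y ω) ∂μ := by
            refine lintegral_congr fun ω => ?_
            rw [gaussianReal_of_var_ne_zero _ hM.var_ne_zero,
              lintegral_withDensity_eq_lintegral_mul _ (measurable_gaussianPDF 0 v)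
                (g := fun u => Θ ((F ω, fun j : Fin n => ξ j ω), u))
                (hΘm.comp measurable_prodMk_left)]
            rw [← lintegral_sub_right_eq_self _ (e (F ω) (X n (Y ω)))]
            refine lintegral_congr fun u => ?_
            simp only [Pi.mul_apply, hΘ]
            rw [add_sub_cancel]
    rw [hstep, ih Ψ' hΨ'm]
    refine lintegral_congr fun ω => ?_
    have hG : Measurable fun y : Fin (n + 1) → ℝ =>
        lik v (e (F ω)) (designPts X (n + 1) y) y * Ψ (F ω, y) := by
      have h1 := (measurable_lik_designPts he hX v (n + 1)).comp (measurable_prodMk_left (x := F ω))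
      have h2 := hΨ.comp (measurable_prodMk_left (x := F ω))
      exact h1.mul h2
    rw [lintegral_fin_succ hG]
    refine lintegral_congr fun y => ?_
    simp only [hΨ']
    have hu := hint.comp (measurable_prodMk_left (x := (F ω, y)))
    simp only [Function.comp_def] at hu
    rw [← lintegral_const_mul _ hu]
    refine lintegral_congr fun u => ?_
    rw [lik_designPts_snoc, mul_assoc]

end Observation

/-! ### Conditioning on the observations of a fixed design -/

section FixedDesign

variable {S E Ω : Type*}

/-- The strategy that queries the points `p` in order, irrespective of the observations. -/
def fixedDesign {n : ℕ} (p : Fin n → E) (z : E) (m : ℕ) (_ : Fin m → ℝ) : E :=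
  -- The value `z` only fills the strategy after its `n` points.
  if h : m < n then p ⟨m, h⟩ else z

lemma designPts_fixedDesign {n : ℕ} (p : Fin n → E) (z : E) (y : Fin n → ℝ) :
    designPts (fixedDesign p z) n y = p := by
  ext i
  simp [designPts, fixedDesign]

lemma gaussianPDF_le (v : NNReal) (u : ℝ) :
    gaussianPDF 0 v u ≤ ENNReal.ofReal (√(2 * Real.pi * v))⁻¹ := by
  refine ENNReal.ofReal_le_ofReal ?_
  rw [gaussianPDFReal]
  refine mul_le_of_le_one_right (by positivity) (Real.exp_le_one_iff.2 ?_)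
  rw [neg_div]
  exact neg_nonpos.2 (by positivity)

lemma continuous_lik (v : NNReal) (h : E → ℝ) {n : ℕ} (p : Fin n → E) : Continuous (lik v h p) := by
  have heq : lik v h p = fun y => ENNReal.ofReal (∏ i, gaussianPDFReal 0 v (y i - h (p i))) := by
    ext y
    rw [ENNReal.ofReal_prod_of_nonneg fun i _ => gaussianPDFReal_nonneg 0 v _]
    simp only [lik, gaussianPDF]
  rw [heq]
  refine ENNReal.continuous_ofReal.comp ?_
  unfold gaussianPDFReal
  fun_prop

/-- A bound independent of path and observations, for dominated convergence. -/
lemma lik_le (v : NNReal) (h : E → ℝ) {n : ℕ} (p : Fin n → E) (y : Fin n → ℝ) :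
    lik v h p y ≤ ENNReal.ofReal (√(2 * Real.pi * v))⁻¹ ^ n := by
  unfold lik
  refine (Finset.prod_le_prod' fun i _ => gaussianPDF_le v _).trans ?_
  simp

variable [MeasurableSpace S] [MeasurableSpace E] [MeasurableSpace Ω]
  {μ : Measure Ω} [IsProbabilityMeasure μ] {e : S → E → ℝ} {F : Ω → S} {ξ : ℕ → Ω → ℝ} {v : NNReal}

/-- The likelihood integrated over the paths for which `g (F ω, y)` holds. -/
lemma IsObservationModel.setLIntegral_lik (hM : IsObservationModel μ e F ξ v) {n : ℕ}
    (p : Fin n → E) (z : E) {R : Set (S × (Fin n → ℝ))} (hR : MeasurableSet R)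
    {B : Set (Fin n → ℝ)} (hB : MeasurableSet B) :
    ∫⁻ y in B, (∫⁻ ω, lik v (e (F ω)) p y * R.indicator 1 (F ω, y) ∂μ) =
      μ {ω | (fun i : Fin n => e (F ω) (p i) + ξ i ω) ∈ B ∧
        (F ω, fun i : Fin n => e (F ω) (p i) + ξ i ω) ∈ R} := by
  have he := hM.measurable_eval
  have hX : ∀ m, Measurable (fixedDesign p z m) := fun m => measurable_const
  have hY : ∀ ω, (obsPath (fixedDesign p z) (e (F ω)) n fun j => ξ j ω) =
      fun i : Fin n => e (F ω) (p i) + ξ i ω := fun ω => by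
    ext i
    rw [obsPath_eq, designPts_fixedDesign]
  have hBR : MeasurableSet ((Prod.snd ⁻¹' B : Set (S × (Fin n → ℝ))) ∩ R) :=
    (measurable_snd hB).inter hR
  have h := hM.lintegral_obsPath hX n
    (((Prod.snd ⁻¹' B : Set (S × (Fin n → ℝ))) ∩ R).indicator 1) (measurable_one.indicator hBR)
  simp only [hY, designPts_fixedDesign] at h
  have hmeas : Measurable fun ω => (F ω, fun i : Fin n => e (F ω) (p i) + ξ i ω) :=
    hM.measurable_path.prodMk (measurable_pi_lambda _ fun i =>
      ((he.comp (hM.measurable_path.prodMk measurable_const)).add (hM.measurable_noise i)))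
  have hl : ∫⁻ ω, ((Prod.snd ⁻¹' B : Set (S × (Fin n → ℝ))) ∩ R).indicator 1
      (F ω, fun i : Fin n => e (F ω) (p i) + ξ i ω) ∂μ =
      μ {ω | (fun i : Fin n => e (F ω) (p i) + ξ i ω) ∈ B ∧
        (F ω, fun i : Fin n => e (F ω) (p i) + ξ i ω) ∈ R} :=
    lintegral_indicator_one (hmeas hBR)
  -- What remains is Tonelli: the `ω`- and `y`-integrals are exchanged and `B` moves into the
  -- indicator.
  rw [← hl, h]
  symm
  rw [lintegral_lintegral_swap, ← lintegral_indicator hB]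
  · refine lintegral_congr fun y => ?_
    by_cases hy : y ∈ B
    · rw [Set.indicator_of_mem hy]
      refine lintegral_congr fun ω => ?_
      by_cases hr : (F ω, y) ∈ R
      · rw [Set.indicator_of_mem hr, Set.indicator_of_mem (Set.mem_inter (by exact hy) hr)]
      · rw [Set.indicator_of_notMem hr,
          Set.indicator_of_notMem fun h => hr (Set.mem_of_mem_inter_right h)]
    · simp [hy, Set.indicator]
  · refine Measurable.aemeasurable ?_
    have hlm : Measurable fun q : Ω × (Fin n → ℝ) => lik v (e (F q.1)) p q.2 := by
      have h1 : Measurable fun q : Ω × (Fin n → ℝ) => (F q.1, p, q.2) :=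
        (hM.measurable_path.comp measurable_fst).prodMk (measurable_const.prodMk measurable_snd)
      exact (measurable_lik he v n).comp h1
    have hF2 : Measurable fun q : Ω × (Fin n → ℝ) => (F q.1, q.2) :=
      (hM.measurable_path.comp measurable_fst).prodMk measurable_snd
    exact hlm.mul ((measurable_one.indicator hBR).comp hF2)

/-- If under a fixed design the sign of the residual at `z` is independent of the observations, then
this holds conditionally on every value `y` of the observations. -/
theorem IsObservationModel.lintegral_lik_residual (hM : IsObservationModel μ e F ξ v) {n : ℕ}
    (p : Fin n → E) (z : E) (w : Fin n → ℝ) (c s : ℝ) (hs : s ≠ 0)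
    (hatom : ∀ x, μ {ω | e (F ω) z = x} = 0) {q : ENNReal} (hq : q ≠ ⊤)
    (hind : ∀ B : Set (Fin n → ℝ), MeasurableSet B →
      μ {ω | (fun i : Fin n => e (F ω) (p i) + ξ i ω) ∈ B ∧
        c < s * (e (F ω) z - w ⬝ᵥ fun i : Fin n => e (F ω) (p i) + ξ i ω)} =
      q * μ {ω | (fun i : Fin n => e (F ω) (p i) + ξ i ω) ∈ B})
    (y : Fin n → ℝ) :
    ∫⁻ ω, lik v (e (F ω)) p y *
        {r : S × (Fin n → ℝ) | c < s * (e r.1 z - w ⬝ᵥ r.2)}.indicator 1 (F ω, y) ∂μ =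
      q * ∫⁻ ω, lik v (e (F ω)) p y ∂μ := by
  have he := hM.measurable_eval
  set R : Set (S × (Fin n → ℝ)) := {r | c < s * (e r.1 z - w ⬝ᵥ r.2)} with hRdef
  have hez : Measurable fun t : S => e t z := he.comp (measurable_id.prodMk measurable_const)
  have hw : Continuous fun y : Fin n → ℝ => w ⬝ᵥ y := by fun_prop
  have hR : MeasurableSet R :=
    measurableSet_lt measurable_const (measurable_const.mul
      ((hez.comp measurable_fst).sub (hw.measurable.comp measurable_snd)))
  have hlm : Measurable fun q : Ω × (Fin n → ℝ) => lik v (e (F q.1)) p q.2 := by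
    have h1 : Measurable fun q : Ω × (Fin n → ℝ) => (F q.1, p, q.2) :=
      (hM.measurable_path.comp measurable_fst).prodMk (measurable_const.prodMk measurable_snd)
    exact (measurable_lik he v n).comp h1
  have hF2 : Measurable fun q : Ω × (Fin n → ℝ) => (F q.1, q.2) :=
    (hM.measurable_path.comp measurable_fst).prodMk measurable_snd
  have hlR : Measurable fun q : Ω × (Fin n → ℝ) =>
      lik v (e (F q.1)) p q.2 * R.indicator 1 (F q.1, q.2) :=
    hlm.mul ((measurable_one.indicator hR).comp hF2)
  set C := ENNReal.ofReal (√(2 * Real.pi * v))⁻¹ ^ n with hC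
  have hCtop : ∫⁻ _ω, C ∂μ ≠ ⊤ := by
    rw [lintegral_const, measure_univ, mul_one]
    exact ENNReal.pow_ne_top ENNReal.ofReal_ne_top
  have hGc : Continuous fun y => ∫⁻ ω, lik v (e (F ω)) p y ∂μ := by
    refine continuous_iff_continuousAt.2 fun y₀ =>
      tendsto_lintegral_filter_of_dominated_convergence (fun _ => C)
      (.of_forall fun y => Measurable.of_uncurry_right (f := fun ω y => lik v (e (F ω)) p y) hlm)
      (.of_forall fun y => .of_forall fun ω => lik_le v _ p y) hCtop
      (.of_forall fun ω => (continuous_lik v _ p).tendsto y₀)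
  have hFc : Continuous fun y => ∫⁻ ω, lik v (e (F ω)) p y * R.indicator 1 (F ω, y) ∂μ := by
    refine continuous_iff_continuousAt.2 fun y₀ =>
      tendsto_lintegral_filter_of_dominated_convergence (fun _ => C)
      (.of_forall fun y => Measurable.of_uncurry_right
        (f := fun ω y => lik v (e (F ω)) p y * R.indicator 1 (F ω, y)) hlR)
      (.of_forall fun y => .of_forall fun ω => ?_) hCtop ?_
    · refine (mul_le_of_le_one_right' ?_).trans (lik_le v _ p y)
      exact Set.indicator_le_self' (fun _ _ => zero_le_one) _
    -- The indicator jumps at `y₀` only for paths with one particular value at `z`, a null event by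
    -- `hatom`. Off it the indicator is locally constant in `y`.
    · have hne : ∀ᵐ ω ∂μ, e (F ω) z ≠ c / s + w ⬝ᵥ y₀ := by
        rw [ae_iff]
        simpa using hatom (c / s + w ⬝ᵥ y₀)
      filter_upwards [hne] with ω hω
      have hne' : s * (e (F ω) z - w ⬝ᵥ y₀) ≠ c := fun h => hω (by
        rw [← h]; field_simp; ring)
      have hcont : Continuous fun y : Fin n → ℝ => s * (e (F ω) z - w ⬝ᵥ y) := by fun_prop
      have hev : ∀ᶠ y in nhds y₀, R.indicator (1 : S × (Fin n → ℝ) → ENNReal) (F ω, y) =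
          R.indicator 1 (F ω, y₀) := by
        rcases lt_or_gt_of_ne hne' with h | h
        · filter_upwards [hcont.continuousAt.eventually_lt continuousAt_const h] with y hy
          simp [R, Set.indicator, hy.not_gt, h.not_gt]
        · filter_upwards [continuousAt_const.eventually_lt hcont.continuousAt h] with y hy
          simp [R, Set.indicator, hy, h]
      have hlim : Filter.Tendsto (fun y => lik v (e (F ω)) p y * R.indicator 1 (F ω, y₀))
          (nhds y₀) (nhds (lik v (e (F ω)) p y₀ * R.indicator 1 (F ω, y₀))) := by
        refine ENNReal.Tendsto.mul_const ((continuous_lik v _ p).tendsto y₀) (Or.inr ?_)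
        exact ne_top_of_le_ne_top ENNReal.one_ne_top
          (Set.indicator_le_self' (fun _ _ => zero_le_one) _)
      refine hlim.congr' ?_
      filter_upwards [hev] with y hy
      rw [hy]
  have hqGc := (ENNReal.continuous_const_mul hq).comp hGc
  have hae : (fun y => ∫⁻ ω, lik v (e (F ω)) p y * R.indicator 1 (F ω, y) ∂μ) =ᵐ[volume]
      fun y => q * ∫⁻ ω, lik v (e (F ω)) p y ∂μ := by
    -- Both sides have equal integrals over every Borel set `B` by `hind`, so they agree almost
    -- everywhere, and by continuity everywhere.
    refine ae_eq_of_forall_setLIntegral_eq_of_sigmaFinite hFc.measurable hqGc.measurable ?_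
    intro B hB _
    rw [hM.setLIntegral_lik p z hR hB, lintegral_const_mul _ hGc.measurable]
    have h1 := hM.setLIntegral_lik p z (R := Set.univ) MeasurableSet.univ hB
    simp only [Set.indicator_univ, Pi.one_apply, mul_one, Set.mem_univ, and_true] at h1
    rw [h1]
    exact hind B hB
  exact congrFun ((Continuous.ae_eq_iff_eq volume hFc hqGc).1 hae) y

end FixedDesign

/-! ### Gaussian residuals, first for fixed and then for adaptive designs -/

section GaussianModel

variable {S E Ω : Type*} [MeasurableSpace S] [MeasurableSpace E] [MeasurableSpace Ω]

/-- An observation model whose objective is a centred Gaussian process with covariance `k` of unit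
diagonal and whose noise has standard deviation `σ`. -/
structure IsGaussianModel (μ : Measure Ω) (e : S → E → ℝ) (F : Ω → S) (ξ : ℕ → Ω → ℝ) (σ : ℝ)
    (k : E → E → ℝ) : Prop where
  model : IsObservationModel μ e F ξ (σ ^ 2).toNNReal
  sigma_pos : 0 < σ
  gaussian : IsGaussianProcess (fun u ω => e (F ω) u) μ
  mean_zero : ∀ u, ∫ ω, e (F ω) u ∂μ = 0
  covariance_eq : ∀ u v, cov[fun ω => e (F ω) u, fun ω => e (F ω) v; μ] = k u v
  kernel_diag : ∀ u, k u u = 1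

variable {μ : Measure Ω} {e : S → E → ℝ} {F : Ω → S} {ξ : ℕ → Ω → ℝ}
  {σ : ℝ} {k : E → E → ℝ}

namespace IsGaussianModel

lemma memLp_objective (hM : IsGaussianModel μ e F ξ σ k) (u : E) :
    MemLp (fun ω => e (F ω) u) 2 μ := (hM.gaussian.hasGaussianLaw_eval u).memLp_two

lemma hasGaussianLaw_noise (hM : IsGaussianModel μ e F ξ σ k) (i : ℕ) : HasGaussianLaw (ξ i) μ where
  isGaussian_map := by rw [hM.model.noise_law]; infer_instance

lemma memLp_noise (hM : IsGaussianModel μ e F ξ σ k) (i : ℕ) : MemLp (ξ i) 2 μ :=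
  (hM.hasGaussianLaw_noise i).memLp_two

variable [IsProbabilityMeasure μ]

lemma isUnitKernel (hM : IsGaussianModel μ e F ξ σ k) : IsUnitKernel k where
  symm u v := by rw [← hM.covariance_eq, covariance_comm, hM.covariance_eq]
  diag := hM.kernel_diag
  nonneg {n} X w z c := by
    -- The form is the variance of `∑ w_i f(X_i) + c f(z)`; the index `none` carries the extra point
    -- `z`.
    let q : Option (Fin n) → E := fun i => i.elim z X
    let a : Option (Fin n) → ℝ := fun i => i.elim c w
    have h := variance_nonneg (fun ω => ∑ i, a i * e (F ω) (q i)) μ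
    rw [variance_fun_sum fun i => (hM.memLp_objective (q i)).const_mul (a i)] at h
    simp only [covariance_const_mul_left, covariance_const_mul_right, hM.covariance_eq,
      Fintype.sum_option, q, a, Option.elim, hM.kernel_diag] at h
    have hs : ∀ u v, k u v = k v u := fun u v => by
      rw [← hM.covariance_eq, covariance_comm, hM.covariance_eq]
    simp only [hs z] at h
    rw [Finset.sum_add_distrib] at h
    have h1 : ∑ i, w i * (c * k (X i) z) = c * ∑ i, w i * k (X i) z := by
      rw [Finset.mul_sum]; exact Finset.sum_congr rfl fun i _ => by ring
    have h2 : ∑ i, c * (w i * k (X i) z) = c * ∑ i, w i * k (X i) z := by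
      rw [Finset.mul_sum]
    have h3 : ∑ i, ∑ j, w j * (w i * k (X i) (X j)) = ∑ i, ∑ j, w i * w j * k (X i) (X j) :=
      Finset.sum_congr rfl fun i _ => Finset.sum_congr rfl fun j _ => by ring
    rw [h1, h2, h3] at h
    linarith

/-- The kernel is `E[f(u) f(v)]`, an integral of a jointly measurable function. -/
lemma measurable_kernel (hM : IsGaussianModel μ e F ξ σ k) : Measurable (Function.uncurry k) := by
  have he := hM.model.measurable_eval
  have h1 : Measurable fun q : (E × E) × Ω => e (F q.2) q.1.1 * e (F q.2) q.1.2 :=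
    (he.comp ((hM.model.measurable_path.comp measurable_snd).prodMk
      (measurable_fst.comp measurable_fst))).mul
    (he.comp ((hM.model.measurable_path.comp measurable_snd).prodMk
      (measurable_snd.comp measurable_fst)))
  have h2 : StronglyMeasurable fun p : E × E => ∫ ω, e (F ω) p.1 * e (F ω) p.2 ∂μ :=
    StronglyMeasurable.integral_prod_right (f := fun (p : E × E) ω => e (F ω) p.1 * e (F ω) p.2)
      h1.stronglyMeasurable
  convert h2.measurable using 1
  ext ⟨u, v⟩
  simp only [Function.uncurry, ← hM.covariance_eq, covariance, hM.mean_zero, sub_zero]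

section Covariance

lemma covariance_objective_noise (hM : IsGaussianModel μ e F ξ σ k) (u : E) (i : ℕ) :
    cov[fun ω => e (F ω) u, ξ i; μ] = 0 := by
  refine IndepFun.covariance_eq_zero ?_ (hM.memLp_objective u) (hM.memLp_noise i)
  exact hM.model.path_indep.comp (φ := fun s => e s u) (ψ := fun x : ℕ → ℝ => x i)
    (hM.model.measurable_eval.comp (measurable_id.prodMk measurable_const)) (measurable_pi_apply i)

lemma covariance_noise (hM : IsGaussianModel μ e F ξ σ k) (i j : ℕ) :
    cov[ξ i, ξ j; μ] = if i = j then σ ^ 2 else 0 := by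
  split_ifs with h
  · subst h
    rw [covariance_self (hM.model.measurable_noise i).aemeasurable,
      ← variance_id_map (hM.model.measurable_noise i).aemeasurable, hM.model.noise_law,
      variance_id_gaussianReal, Real.coe_toNNReal _ (sq_nonneg σ)]
  · exact (hM.model.noise_indep.indepFun h).covariance_eq_zero (hM.memLp_noise i) (hM.memLp_noise j)

lemma memLp_obs (hM : IsGaussianModel μ e F ξ σ k) (u : E) (i : ℕ) :
    MemLp (fun ω => e (F ω) u + ξ i ω) 2 μ := (hM.memLp_objective u).add (hM.memLp_noise i)

lemma covariance_obs_objective (hM : IsGaussianModel μ e F ξ σ k) (u v : E) (i : ℕ) :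
    cov[fun ω => e (F ω) u + ξ i ω, fun ω => e (F ω) v; μ] = k u v := by
  refine (covariance_add_left (hM.memLp_objective u) (hM.memLp_noise i)
    (hM.memLp_objective v)).trans ?_
  rw [hM.covariance_eq, covariance_comm, hM.covariance_objective_noise, add_zero]

lemma covariance_obs_obs (hM : IsGaussianModel μ e F ξ σ k) (u v : E) (i j : ℕ) :
    cov[fun ω => e (F ω) u + ξ i ω, fun ω => e (F ω) v + ξ j ω; μ] =
      k u v + if i = j then σ ^ 2 else 0 := by
  have h : cov[fun ω => e (F ω) u + ξ i ω, ξ j; μ] = if i = j then σ ^ 2 else 0 := by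
    refine (covariance_add_left (hM.memLp_objective u) (hM.memLp_noise i)
      (hM.memLp_noise j)).trans ?_
    rw [hM.covariance_objective_noise, hM.covariance_noise, zero_add]
  refine (covariance_add_right (hM.memLp_obs u i) (hM.memLp_objective v)
    (hM.memLp_noise j)).trans ?_
  rw [hM.covariance_obs_objective, h]

variable {n : ℕ} (p : Fin n → E) (z : E)

/-- The error of the posterior mean under a fixed design. -/
def residual (e : S → E → ℝ) (F : Ω → S) (ξ : ℕ → Ω → ℝ) (σ : ℝ) (k : E → E → ℝ) {n : ℕ}
    (p : Fin n → E) (z : E) (ω : Ω) : ℝ :=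
  e (F ω) z - ∑ i, postWeights k σ p z i * (e (F ω) (p i) + ξ i ω)

lemma memLp_residual (hM : IsGaussianModel μ e F ξ σ k) :
    MemLp (residual e F ξ σ k p z) 2 μ :=
  (hM.memLp_objective z).sub
    (memLp_finsetSum _ fun i _ => (hM.memLp_obs (p i) i).const_mul (postWeights k σ p z i))

lemma covariance_residual (hM : IsGaussianModel μ e F ξ σ k) {V : Ω → ℝ} (hV : MemLp V 2 μ) :
    cov[residual e F ξ σ k p z, V; μ] = cov[fun ω => e (F ω) z, V; μ] -
      ∑ i, postWeights k σ p z i * cov[fun ω => e (F ω) (p i) + ξ i ω, V; μ] := by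
  have hm := fun i : Fin n => (hM.memLp_obs (p i) i).const_mul (postWeights k σ p z i)
  unfold residual
  rw [covariance_fun_sub_left (hM.memLp_objective z) (memLp_finsetSum _ fun i _ => hm i) hV,
    covariance_fun_sum_left hm hV]
  simp only [covariance_const_mul_left]

/-- These are the normal equations `(K + σ²I) w = k(z)` that define the weights. -/
lemma covariance_residual_obs (hM : IsGaussianModel μ e F ξ σ k) (j : Fin n) :
    cov[residual e F ξ σ k p z, fun ω => e (F ω) (p j) + ξ j ω; μ] = 0 := by
  rw [hM.covariance_residual p z (hM.memLp_obs _ _), covariance_comm, hM.covariance_obs_objective]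
  have h := congrFun (hM.isUnitKernel.regGram_mulVec_postWeights hM.sigma_pos p z) j
  simp only [Matrix.mulVec, dotProduct, regGram, Matrix.add_apply, Matrix.of_apply,
    Matrix.smul_apply, Matrix.one_apply, smul_eq_mul, mul_ite, mul_one, mul_zero, kvec] at h
  rw [sub_eq_zero, ← h]
  refine Finset.sum_congr rfl fun i _ => ?_
  rw [hM.covariance_obs_obs, hM.isUnitKernel.symm, mul_comm]
  simp only [Fin.val_inj, eq_comm]

/-- The residual is orthogonal to the observations, so its variance is its covariance with `f(z)`.
-/
lemma variance_residual (hM : IsGaussianModel μ e F ξ σ k) :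
    Var[residual e F ξ σ k p z; μ] = postVar k σ p z := by
  have hR := hM.memLp_residual p z
  rw [← covariance_self hR.aestronglyMeasurable.aemeasurable, hM.covariance_residual p z hR]
  have h0 : ∀ i : Fin n, cov[fun ω => e (F ω) (p i) + ξ i ω, residual e F ξ σ k p z; μ] = 0 :=
    fun i => by rw [covariance_comm, hM.covariance_residual_obs]
  simp only [h0, mul_zero, Finset.sum_const_zero, sub_zero]
  rw [covariance_comm, hM.covariance_residual p z (hM.memLp_objective z), hM.covariance_eq,
    hM.kernel_diag, hM.isUnitKernel.postVar_eq]
  simp only [hM.covariance_obs_objective]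

lemma integral_residual (hM : IsGaussianModel μ e F ξ σ k) :
    ∫ ω, residual e F ξ σ k p z ω ∂μ = 0 := by
  have hi : ∀ u, Integrable (fun ω => e (F ω) u) μ :=
    fun u => (hM.memLp_objective u).integrable one_le_two
  have hξ : ∀ i, Integrable (ξ i) μ := fun i => (hM.memLp_noise i).integrable one_le_two
  have hξ0 : ∀ i, ∫ ω, ξ i ω ∂μ = 0 := fun i => by
    have h := integral_map (hM.model.measurable_noise i).aemeasurable
      (f := fun x : ℝ => x) (μ := μ) (by fun_prop)
    rw [← h, hM.model.noise_law, integral_id_gaussianReal]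
  have hY : ∀ i : Fin n, Integrable (fun ω => e (F ω) (p i) + ξ i ω) μ :=
    fun i => (hi _).add (hξ i)
  unfold residual
  rw [integral_sub (hi z) (integrable_finsetSum _ fun i _ => (hY i).const_mul _),
    integral_finsetSum _ fun i _ => (hY i).const_mul _, hM.mean_zero]
  simp [integral_const_mul, integral_add (hi _) (hξ _), hM.mean_zero, hξ0]

/-- The pair is a linear image of the values of `f` and the noise, two independent Gaussian vectors.
Joint normality is what turns zero covariance into independence. -/
lemma hasGaussianLaw_residual_obs (hM : IsGaussianModel μ e F ξ σ k) :
    HasGaussianLaw (fun ω => ((fun _ : Unit => residual e F ξ σ k p z ω),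
      fun i : Fin n => e (F ω) (p i) + ξ i ω)) μ := by
  classical
  let q : Option (Fin n) → E := fun i => i.elim z p
  have h1 : HasGaussianLaw (fun ω (i : Option (Fin n)) => e (F ω) (q i)) μ := by
    let L : (Finset.univ.image q → ℝ) →L[ℝ] (Option (Fin n) → ℝ) :=
      ContinuousLinearMap.pi fun i => ContinuousLinearMap.proj
        ⟨q i, Finset.mem_image_of_mem q (Finset.mem_univ i)⟩
    exact (hM.gaussian.hasGaussianLaw (Finset.univ.image q)).map L
  have h2 : HasGaussianLaw (fun ω (i : Fin n) => ξ i ω) μ :=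
    iIndepFun.hasGaussianLaw (fun i : Fin n => hM.hasGaussianLaw_noise i)
      (hM.model.noise_indep.precomp Fin.val_injective)
  have h3 : IndepFun (fun ω (i : Option (Fin n)) => e (F ω) (q i)) (fun ω (i : Fin n) => ξ i ω) μ :=
    hM.model.path_indep.comp (φ := fun s (i : Option (Fin n)) => e s (q i))
      (ψ := fun (x : ℕ → ℝ) (i : Fin n) => x i)
      (measurable_pi_lambda _ fun i =>
        hM.model.measurable_eval.comp (measurable_id.prodMk measurable_const))
      (measurable_pi_lambda _ fun i => measurable_pi_apply _)
  let L : ((Option (Fin n) → ℝ) × (Fin n → ℝ)) →ₗ[ℝ] ((Unit → ℝ) × (Fin n → ℝ)) :=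
    { toFun := fun a => (fun _ => a.1 none - ∑ i, postWeights k σ p z i * (a.1 (some i) + a.2 i),
        fun i => a.1 (some i) + a.2 i)
      map_add' := fun a b => by
        ext
        · simp only [Prod.fst_add, Pi.add_apply, Prod.snd_add, mul_add, Finset.sum_add_distrib]
          ring
        · simp only [Prod.fst_add, Pi.add_apply, Prod.snd_add]
          ring
      map_smul' := fun c a => by
        ext
        · simp only [Prod.smul_fst, Prod.smul_snd, Pi.smul_apply, smul_eq_mul, RingHom.id_apply,
            mul_sub, Finset.mul_sum]
          congr 1
          exact Finset.sum_congr rfl fun i _ => by ring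
        · simp only [Prod.smul_fst, Prod.smul_snd, Pi.smul_apply, smul_eq_mul, RingHom.id_apply]
          ring }
  exact (h3.hasGaussianLaw h1 h2).map L.toContinuousLinearMap

lemma indepFun_residual_obs (hM : IsGaussianModel μ e F ξ σ k) :
    IndepFun (residual e F ξ σ k p z) (fun ω (i : Fin n) => e (F ω) (p i) + ξ i ω) μ := by
  have h := HasGaussianLaw.indepFun_of_covariance_eval
    (X := fun _ : Unit => residual e F ξ σ k p z) (Y := fun (i : Fin n) ω => e (F ω) (p i) + ξ i ω)
    (hM.hasGaussianLaw_residual_obs p z) (fun _ j => hM.covariance_residual_obs p z j)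
  exact h.comp (φ := fun a : Unit → ℝ => a ()) (measurable_pi_apply ()) measurable_id

lemma map_residual (hM : IsGaussianModel μ e F ξ σ k) :
    μ.map (residual e F ξ σ k p z) = gaussianReal 0 (postVar k σ p z).toNNReal := by
  have h : HasGaussianLaw (residual e F ξ σ k p z) μ :=
    (hM.hasGaussianLaw_residual_obs p z).fst.map (ContinuousLinearMap.proj ())
  rw [h.map_eq_gaussianReal, hM.integral_residual, hM.variance_residual]

lemma gaussianReal_Ioi (c : ℝ) : gaussianReal 0 1 (Set.Ioi c) = ENNReal.ofReal (1 - Phi c) := by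
  rw [← Set.compl_Iic, prob_compl_eq_one_sub measurableSet_Iic, Phi, cdf_eq_real,
    ENNReal.ofReal_sub _ measureReal_nonneg, ENNReal.ofReal_one, ofReal_measureReal]

/-- The residual exceeds `c` posterior standard deviations with probability `1 - Φ(c)`. -/
lemma measure_residual_gt (hM : IsGaussianModel μ e F ξ σ k) {s : ℝ} (hs : s ^ 2 = 1) (c : ℝ) :
    μ {ω | c * postStd k σ p z < s * residual e F ξ σ k p z ω} = ENNReal.ofReal (1 - Phi c) := by
  have hpos := hM.isUnitKernel.postVar_pos hM.sigma_pos p z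
  have hsd : 0 < postStd k σ p z := Real.sqrt_pos.2 hpos
  have hsq : postStd k σ p z ^ 2 = postVar k σ p z := Real.sq_sqrt hpos.le
  have hR := (hM.memLp_residual p z).aestronglyMeasurable.aemeasurable
  -- Since `s = ±1`, scaling by `s / postStd` standardizes the residual for either tail.
  have hmap : μ.map (fun ω => s / postStd k σ p z * residual e F ξ σ k p z ω) =
      gaussianReal 0 1 := by
    have h := AEMeasurable.map_map_of_aemeasurable
      (g := fun x => s / postStd k σ p z * x) (by fun_prop) hR
    rw [hM.map_residual, gaussianReal_map_const_mul] at h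
    refine Eq.trans h.symm ?_
    congr 1
    · simp
    · apply NNReal.eq
      simp only [NNReal.coe_mul, NNReal.coe_mk, Real.coe_toNNReal _ hpos.le, NNReal.coe_one]
      rw [div_pow, hs, hsq, one_div_mul_cancel hpos.ne']
  rw [← gaussianReal_Ioi, ← hmap, Measure.map_apply_of_aemeasurable (by fun_prop) measurableSet_Ioi]
  congr 1
  ext ω
  simp only [Set.mem_ofPred_eq, Set.mem_preimage, Set.mem_Ioi]
  rw [div_mul_eq_mul_div, lt_div_iff₀ hsd]

lemma measure_objective_eq (hM : IsGaussianModel μ e F ξ σ k) (x : ℝ) :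
    μ {ω | e (F ω) z = x} = 0 := by
  have h := (hM.gaussian.hasGaussianLaw_eval z).map_eq_gaussianReal
  have hv : Var[fun ω => e (F ω) z; μ] = 1 := by
    rw [← covariance_self (hM.gaussian.aemeasurable z), hM.covariance_eq, hM.kernel_diag]
  rw [hv] at h
  have : NullSingletonClass (μ.map fun ω => e (F ω) z) := by
    rw [h]; exact nullSingletonClass_gaussianReal (by simp)
  have h1 := measure_singleton (μ := μ.map fun ω => e (F ω) z) x
  rwa [Measure.map_apply_of_aemeasurable (hM.gaussian.aemeasurable z)
    (measurableSet_singleton x)] at h1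

end Covariance

/-- For an adaptive strategy `X` and a point `z` chosen from the observations, the error of the
posterior mean at `z` exceeds `c` posterior standard deviations with probability `1 - Φ(c)`. -/
theorem measure_adaptive_residual_gt (hM : IsGaussianModel μ e F ξ σ k)
    {X : ∀ n, (Fin n → ℝ) → E} (hX : ∀ n, Measurable (X n)) {n : ℕ} {z : (Fin n → ℝ) → E}
    (hz : Measurable z) {s : ℝ} (hs : s ^ 2 = 1) (c : ℝ) :
    MeasurableSet {r : S × (Fin n → ℝ) | c * postStd k σ (designPts X n r.2) (z r.2) <
        s * (e r.1 (z r.2) - postMean k σ (designPts X n r.2) r.2 (z r.2))} ∧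
    μ {ω | (F ω, obsPath X (e (F ω)) n fun j => ξ j ω) ∈
        {r : S × (Fin n → ℝ) | c * postStd k σ (designPts X n r.2) (z r.2) <
          s * (e r.1 (z r.2) - postMean k σ (designPts X n r.2) r.2 (z r.2))}} =
      ENNReal.ofReal (1 - Phi c) := by
  have he := hM.model.measurable_eval
  have hk := hM.isUnitKernel
  have hD := measurable_designPts hX n
  set R : Set (S × (Fin n → ℝ)) := {r | c * postStd k σ (designPts X n r.2) (z r.2) <
        s * (e r.1 (z r.2) - postMean k σ (designPts X n r.2) r.2 (z r.2))} with hRdef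
  have hR : MeasurableSet R := by
    have h1 : Measurable fun y => postStd k σ (designPts X n y) (z y) :=
      (hk.measurable_postVar hM.measurable_kernel hD hz).sqrt
    have hw := measurable_postWeights hM.measurable_kernel (σ := σ) hD hz
    have h2 : Measurable fun y => postMean k σ (designPts X n y) y (z y) := by
      simp only [hk.postMean_eq, dotProduct]
      exact Finset.measurable_sum _ fun i _ =>
        (Measurable.fun_comp (measurable_pi_apply i) hw).mul (measurable_pi_apply i)
    have h3 : Measurable fun r : S × (Fin n → ℝ) => e r.1 (z r.2) :=
      he.comp (measurable_fst.prodMk (hz.comp measurable_snd))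
    exact measurableSet_lt (measurable_const.mul (h1.comp measurable_snd))
      (measurable_const.mul (h3.sub (h2.comp measurable_snd)))
  refine ⟨hR, ?_⟩
  have hY : Measurable fun ω => (F ω, obsPath X (e (F ω)) n fun j => ξ j ω) :=
    hM.model.measurable_path.prodMk ((measurable_obsPath he hX n).comp
      (hM.model.measurable_path.prodMk
        (measurable_pi_lambda _ fun j => hM.model.measurable_noise j)))
  have hlik : Measurable fun q : Ω × (Fin n → ℝ) =>
      lik (σ ^ 2).toNNReal (e (F q.1)) (designPts X n q.2) q.2 := by
    have h1 : Measurable fun q : Ω × (Fin n → ℝ) => (F q.1, q.2) :=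
      (hM.model.measurable_path.comp measurable_fst).prodMk measurable_snd
    exact (measurable_lik_designPts he hX _ n).comp h1
  have hlikR : Measurable fun q : Ω × (Fin n → ℝ) =>
      lik (σ ^ 2).toNNReal (e (F q.1)) (designPts X n q.2) q.2 * R.indicator 1 (F q.1, q.2) := by
    have h1 : Measurable fun q : Ω × (Fin n → ℝ) => (F q.1, q.2) :=
      (hM.model.measurable_path.comp measurable_fst).prodMk measurable_snd
    exact hlik.mul ((measurable_one.indicator hR).comp h1)
  -- With `y` frozen, `designPts X n y` is a fixed design and `z y` a fixed point, so the
  -- fixed-design identity applies at this single `y`.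
  have hpt : ∀ y, ∫⁻ ω, lik (σ ^ 2).toNNReal (e (F ω)) (designPts X n y) y *
      R.indicator 1 (F ω, y) ∂μ = ENNReal.ofReal (1 - Phi c) *
        ∫⁻ ω, lik (σ ^ 2).toNNReal (e (F ω)) (designPts X n y) y ∂μ := by
    intro y
    have hres : ∀ ω, e (F ω) (z y) - (postWeights k σ (designPts X n y) (z y) ⬝ᵥ
        fun i : Fin n => e (F ω) (designPts X n y i) + ξ i ω) =
        residual e F ξ σ k (designPts X n y) (z y) ω := fun ω => rfl
    have h := hM.model.lintegral_lik_residual (designPts X n y) (z y)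
      (postWeights k σ (designPts X n y) (z y)) (c * postStd k σ (designPts X n y) (z y)) s
      (by rintro rfl; norm_num at hs) (hM.measure_objective_eq (z y))
      (q := ENNReal.ofReal (1 - Phi c)) ENNReal.ofReal_ne_top (fun B hB => ?_) y
    · rw [← h]
      refine lintegral_congr fun ω => ?_
      simp only [R, Set.indicator, Set.mem_ofPred_eq, hk.postMean_eq]
    · simp only [hres]
      have hi := (hM.indepFun_residual_obs (designPts X n y) (z y)).measure_inter_preimage_eq_mul
        {x | c * postStd k σ (designPts X n y) (z y) < s * x} B
        (measurableSet_lt measurable_const (measurable_const.mul measurable_id)) hB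
      rw [Set.inter_comm] at hi
      have hg := hM.measure_residual_gt (designPts X n y) (z y) hs c
      simp only [Set.preimage_ofPred_eq] at hi
      rw [hg] at hi
      exact hi
  -- The case `Ψ = 1`: the likelihood has total mass one.
  have hone := hM.model.lintegral_obsPath hX n (fun _ => 1) measurable_const
  simp only [lintegral_const, measure_univ, mul_one] at hone
  calc μ {ω | (F ω, obsPath X (e (F ω)) n fun j => ξ j ω) ∈ R}
      = ∫⁻ ω, R.indicator 1 (F ω, obsPath X (e (F ω)) n fun j => ξ j ω) ∂μ :=
        (lintegral_indicator_one (hY hR)).symm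
    _ = ∫⁻ ω, (∫⁻ y, lik (σ ^ 2).toNNReal (e (F ω)) (designPts X n y) y *
          R.indicator 1 (F ω, y)) ∂μ :=
        hM.model.lintegral_obsPath hX n _ (measurable_one.indicator hR)
    _ = ∫⁻ y, (∫⁻ ω, lik (σ ^ 2).toNNReal (e (F ω)) (designPts X n y) y *
          R.indicator 1 (F ω, y) ∂μ) := lintegral_lintegral_swap hlikR.aemeasurable
    _ = ∫⁻ y, ENNReal.ofReal (1 - Phi c) *
          (∫⁻ ω, lik (σ ^ 2).toNNReal (e (F ω)) (designPts X n y) y ∂μ) := lintegral_congr hpt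
    _ = ENNReal.ofReal (1 - Phi c) *
          ∫⁻ y, (∫⁻ ω, lik (σ ^ 2).toNNReal (e (F ω)) (designPts X n y) y ∂μ) :=
        lintegral_const_mul' _ _ ENNReal.ofReal_ne_top
    _ = ENNReal.ofReal (1 - Phi c) := by
        rw [← lintegral_lintegral_swap hlik.aemeasurable, ← hone, mul_one]

end IsGaussianModel

end GaussianModel

/-! ### The 1-norm on the domain -/

section Domain

variable {d : ℕ} {D : Set (Fin d → ℝ)}

lemma continuous_of_dist1_le {g : D → ℝ} {L : ℝ}
    (h : ∀ u v : D, |g u - g v| ≤ L * dist1 (u : Fin d → ℝ) v) : Continuous g := by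
  refine continuous_iff_continuousAt.2 fun v => ?_
  have hc : Continuous fun u : D => L * dist1 (u : Fin d → ℝ) v := by
    refine continuous_const.mul (continuous_finsetSum _ fun i _ => Continuous.abs ?_)
    exact ((continuous_apply i).comp continuous_subtype_val).sub continuous_const
  refine tendsto_iff_dist_tendsto_zero.2 (squeeze_zero (fun _ => dist_nonneg) (fun u => h u v) ?_)
  have h0 := hc.tendsto v
  simpa [dist1] using h0

lemma eq_of_dist1_nonpos {u v : Fin d → ℝ} (h : dist1 u v ≤ 0) : u = v := by
  have h0 := (Finset.sum_eq_zero_iff_of_nonneg fun i _ => abs_nonneg (u i - v i)).1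
    (le_antisymm h (Finset.sum_nonneg fun i _ => abs_nonneg _))
  ext i
  exact sub_eq_zero.1 (abs_eq_zero.1 (h0 i (Finset.mem_univ i)))

end Domain

/-! ### Runs as strategies -/

section Run

variable {Ω E : Type*}

/-- The points of a run are measurable functions of the past observations alone. -/
lemma IsRun.exists_strategy [MeasurableSpace E] [StandardBorelSpace E] [Nonempty E] {k : E → E → ℝ} {σ : ℝ}
    {β : ℕ → ℝ} {f : E → Ω → ℝ} {ε : ℕ → Ω → ℝ} {t₀ : ℕ} {x : ℕ → Ω → E}
    (hx : IsRun k σ β f ε t₀ x) :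
    ∃ X : ∀ n, (Fin n → ℝ) → E, (∀ n, Measurable (X n)) ∧
      ∀ n ω, x (n + 1) ω = X n (pastObs f ε x (n + 1) ω) := by
  have h : ∀ n, ∃ Xn : (Fin n → ℝ) → E, Measurable Xn ∧
      ∀ ω, x (n + 1) ω = Xn (pastObs f ε x (n + 1) ω) := by
    intro n
    induction n using Nat.strong_induction_on with
    | _ n ih =>
      choose G hG hGx using ih
      -- Doob–Dynkin: `x_{n+1}` is a measurable function of past points and observations. By
      -- induction the past points are themselves functions of the observations.
      obtain ⟨g, hg, hgx⟩ := (hx.adapted (n + 1) (Nat.le_add_left 1 n)).exists_eq_measurable_comp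
      refine ⟨fun y => g (fun j : Fin n => G j j.2 fun i => y (Fin.castLE j.2.le i), y), ?_, ?_⟩
      · refine hg.comp (Measurable.prodMk (measurable_pi_lambda _ fun j => ?_) measurable_id)
        exact (hG j j.2).comp (measurable_pi_lambda _ fun i => measurable_pi_apply _)
      · intro ω
        rw [hgx]
        refine congrArg g (Prod.ext ?_ rfl)
        ext j
        exact hGx j j.2 ω
  choose X hX hXx using h
  exact ⟨X, hX, hXx⟩

lemma pastPoints_eq_designPts {f : E → Ω → ℝ} {ε : ℕ → Ω → ℝ} {x : ℕ → Ω → E}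
    {X : ∀ n, (Fin n → ℝ) → E} (hXx : ∀ n ω, x (n + 1) ω = X n (pastObs f ε x (n + 1) ω))
    (n : ℕ) (ω : Ω) :
    pastPoints x (n + 1) ω = designPts X n (pastObs f ε x (n + 1) ω) := by
  ext j
  exact hXx j ω

/-- Links a run to the observation model; the noise is shifted by one because iterations start at 1.
-/
lemma obsPath_eq_pastObs {f : E → Ω → ℝ} {ε : ℕ → Ω → ℝ} {x : ℕ → Ω → E}
    {X : ∀ n, (Fin n → ℝ) → E} (hXx : ∀ n ω, x (n + 1) ω = X n (pastObs f ε x (n + 1) ω))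
    (n : ℕ) (ω : Ω) :
    (obsPath X (fun u => f u ω) n fun j => ε (j + 1) ω) = pastObs f ε x (n + 1) ω := by
  induction n with
  | zero => exact Subsingleton.elim (α := Fin 0 → ℝ) _ _
  | succ n ih =>
    have ih' : obsPath X (fun u => f u ω) n
        (Fin.init (α := fun _ => ℝ) fun j : Fin (n + 1) => ε (j + 1) ω) =
        pastObs f ε x (n + 1) ω := ih
    rw [obsPath, ih']
    ext j
    refine Fin.lastCases ?_ (fun j => ?_) j
    · rw [Fin.snoc_last, ← hXx]
      rfl
    · rw [Fin.snoc_castSucc]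
      rfl

end Run

/-! ### Continuous paths and the discretization error -/

section Setting

variable {d : ℕ} {Ω : Type*} [MeasurableSpace Ω] {μ : Measure Ω} [IsProbabilityMeasure μ]
  {D : Set (Fin d → ℝ)} {r a b σ : ℝ} {k : D → D → ℝ} {f : D → Ω → ℝ} {ε : ℕ → Ω → ℝ}

/-- The probability that the path is not `L`-Lipschitz is at most `d a exp(-L²/b²)`, which vanishes
as `L = n + 1` tends to infinity. -/
lemma BayesianSetting.exists_continuous_paths (hset : BayesianSetting μ D r a b σ k f ε)
    (hb : 0 < b) :
    ∃ A : Set Ω, MeasurableSet A ∧ μ Aᶜ = 0 ∧ ∀ ω ∈ A, Continuous fun u => f u ω := by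
  choose A hA hAf hAp using fun n : ℕ => hset.lipschitz (n + 1) (by positivity)
  refine ⟨⋃ n, A n, .iUnion hA, ?_, fun ω hω => ?_⟩
  · rw [prob_compl_eq_zero_iff (.iUnion hA)]
    have hlim : Filter.Tendsto
        (fun n : ℕ => 1 - d * a * Real.exp (-((n : ℝ) + 1) ^ 2 / b ^ 2)) Filter.atTop
        (nhds (1 - d * a * 0)) := by
      refine tendsto_const_nhds.sub (Filter.Tendsto.const_mul _ (Real.tendsto_exp_atBot.comp ?_))
      have h1 : Filter.Tendsto (fun n : ℕ => ((n : ℝ) + 1) ^ 2) Filter.atTop Filter.atTop :=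
        (Filter.tendsto_pow_atTop two_ne_zero).comp
          (Filter.tendsto_atTop_add_const_right _ _ tendsto_natCast_atTop_atTop)
      have h2 := Filter.tendsto_neg_atTop_atBot.comp
        (h1.atTop_div_const (show 0 < b ^ 2 by positivity))
      refine h2.congr fun n => ?_
      simp [neg_div]
    have h1 : 1 ≤ μ.real (⋃ n, A n) := by
      refine le_of_tendsto' (by simpa using hlim) fun n => (hAp n).trans ?_
      exact measureReal_mono (Set.subset_iUnion A n)
    rw [← ENNReal.toReal_eq_one_iff]
    exact le_antisymm measureReal_le_one h1
  · obtain ⟨n, hn⟩ := Set.mem_iUnion.1 hω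
    exact continuous_of_dist1_le (hAf n ω hn)

/-- The continuous version of the objective, which vanishes off `A`. -/
def contPath (f : D → Ω → ℝ) (A : Set Ω) (hA : ∀ ω ∈ A, Continuous fun u => f u ω) (ω : Ω) :
    {h : D → ℝ // Continuous h} :=
  ⟨fun u => A.indicator (f u) ω, by
    by_cases hω : ω ∈ A
    · simpa [hω] using hA ω hω
    · simpa [hω] using continuous_const⟩

/-- The continuous version differs from `f` only on a null set, so laws, covariances and
independence carry over. -/
lemma BayesianSetting.isGaussianModel (hset : BayesianSetting μ D r a b σ k f ε) (hσ : 0 < σ)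
    {A : Set Ω} (hAm : MeasurableSet A) (hA0 : μ Aᶜ = 0)
    (hA : ∀ ω ∈ A, Continuous fun u => f u ω) :
    IsGaussianModel μ (fun (h : {h : D → ℝ // Continuous h}) u => h.1 u) (contPath f A hA)
      (fun n => ε (n + 1)) σ k := by
  have hAae : ∀ᵐ ω ∂μ, ω ∈ A := mem_ae_iff.2 hA0
  have hfae : ∀ u, f u =ᵐ[μ] fun ω => (contPath f A hA ω).1 u := fun u => by
    filter_upwards [hAae] with ω hω
    simp [contPath, hω]
  have hind : IndepFun (fun ω => (contPath f A hA ω).1) (fun ω n => ε (n + 1) ω) μ := by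
    have h := hset.noise_indep_f.comp (φ := id) (ψ := fun (e : ℕ → ℝ) n => e (n + 1))
      measurable_id (measurable_pi_lambda _ fun n => measurable_pi_apply _)
    refine h.congr ?_ (Filter.EventuallyEq.refl _ _)
    filter_upwards [hAae] with ω hω
    ext u
    simp [contPath, hω]
  refine
    { model :=
        { measurable_eval := ?_
          measurable_path := ?_
          measurable_noise := fun n => hset.measurable_noise _
          var_ne_zero := by simpa using hσ.ne'
          noise_law := fun n => hset.noise_law _
          noise_indep := hset.noise_indep.precomp (add_left_injective 1)
          path_indep := ?_ }
      sigma_pos := hσ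
      gaussian := hset.gaussian.congr hfae
      mean_zero := fun u => by rw [← integral_congr_ae (hfae u), hset.mean_zero]
      covariance_eq := fun u v => by
        rw [← hset.covariance_eq u v]
        rw [covariance, covariance, ← integral_congr_ae (hfae u), ← integral_congr_ae (hfae v)]
        refine integral_congr_ae ?_
        filter_upwards [hfae u, hfae v] with ω hu hv
        rw [hu, hv]
      kernel_diag := hset.kernel_diag }
  -- Evaluation is continuous in the point and measurable in the path, hence jointly measurable.
  · have h := measurable_uncurry_of_continuous_of_measurable
      (u := fun (u : D) (h : {h : D → ℝ // Continuous h}) => h.1 u) (fun h => h.2)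
      (fun u => (measurable_pi_apply u).comp measurable_subtype_coe)
    exact h.comp measurable_swap
  · exact Measurable.subtype_mk (measurable_pi_lambda _ fun u => (hset.measurable_f u).indicator hAm)
  -- The path space carries the σ-algebra pulled back from the product, so `contPath` generates the
  -- same σ-algebra as its coordinates.
  · rw [IndepFun_iff_Indep] at hind ⊢
    refine cast ?_ hind
    congr 1
    exact (MeasurableSpace.comap_comp (g := contPath f A hA) (f := Subtype.val)).symm

/-- With probability `1 - δ/n_L`, the discretization loses at most `t^{-s}`. -/
lemma BayesianSetting.discretization_error (hset : BayesianSetting μ D r a b σ k f ε)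
    (ha : 0 < a) (hb : 0 < b) {δ : ℝ} (hδ : 0 < δ) {t : ℕ} (ht : 1 ≤ t) {nL s : ℝ} (hnL : 1 < nL)
    {N : ℕ} {𝔻 : Fin N → D} (h𝔻 : IsDiscretization a b r δ nL s t 𝔻) :
    HoldsWithProb μ (1 - δ / nL) fun ω => ∀ u, ∃ j, f u ω ≤ f (𝔻 j) ω + 1 / (t : ℝ) ^ s := by
  have hts : 0 < (t : ℝ) ^ s := Real.rpow_pos_of_pos (by exact_mod_cast ht) s
  set l := Real.log (nL * d * a / δ) with hl
  -- If `l ≤ 0`, then `√l = 0` and division by zero makes the mesh `0`: every point of `D` belongs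
  -- to the discretization.
  rcases le_or_gt l 0 with h | h
  · refine ⟨Set.univ, .univ, fun ω _ u => ?_, ?_⟩
    · obtain ⟨j, hj⟩ := h𝔻.covers u
      rw [mesh, ← hl, Real.sqrt_eq_zero_of_nonpos h] at hj
      have : u = 𝔻 j := Subtype.ext (eq_of_dist1_nonpos (by simpa using hj))
      exact ⟨j, by rw [← this]; exact le_add_of_nonneg_right (by positivity)⟩
    · rw [probReal_univ]
      have : 0 ≤ δ / nL := by positivity
      linarith
  -- With `L = b√l` the failure probability is `d a exp(-l) = δ / n_L`, and `L` times the mesh width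
  -- is `t^{-s}`.
  · have hL : 0 < b * √l := mul_pos hb (Real.sqrt_pos.2 h)
    obtain ⟨A, hA, hAf, hAp⟩ := hset.lipschitz (b * √l) hL
    refine ⟨A, hA, fun ω hω u => ?_, le_trans (le_of_eq ?_) hAp⟩
    · obtain ⟨j, hj⟩ := h𝔻.covers u
      refine ⟨j, ?_⟩
      have h1 := (le_abs_self _).trans (hAf ω hω u (𝔻 j))
      have h2 := mul_le_mul_of_nonneg_left hj hL.le
      have h3 : b * √l * mesh d a b δ nL s t = 1 / (t : ℝ) ^ s := by
        rw [mesh, ← hl]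
        field_simp
      linarith
    · have hd : (d : ℝ) ≠ 0 := fun h0 => by
        rw [hl, h0] at h
        simp at h
      have hd0 : (0 : ℝ) < d := lt_of_le_of_ne (Nat.cast_nonneg d) hd.symm
      have he : -(b * √l) ^ 2 / b ^ 2 = -l := by
        rw [mul_pow, Real.sq_sqrt h.le]
        field_simp
      rw [he, Real.exp_neg, hl, Real.exp_log (by positivity)]
      field_simp

end Setting

end GPUCB

end

/-! ### The regret bound -/

open GPUCB in
theorem mainTheorem2 {d : ℕ} {Ω : Type*} [MeasurableSpace Ω] (μ : Measure Ω)
    [IsProbabilityMeasure μ] (D : Set (Fin d → ℝ)) (r a b σ : ℝ)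
    (hr : 0 < r) (ha : 0 < a) (hb : 0 < b) (hσ : 0 < σ)
    (k : D → D → ℝ) (f : D → Ω → ℝ) (ε : ℕ → Ω → ℝ)
    (hset : GPUCB.BayesianSetting μ D r a b σ k f ε)
    (δ : ℝ) (hδ : δ ∈ Set.Ioo (0 : ℝ) 1)
    (t₀ : ℕ) (ht₀ : 1 ≤ t₀) (x : ℕ → Ω → D)
    (hx : GPUCB.IsRun k σ (GPUCB.beta d a b r δ) f ε t₀ x)
    (t : ℕ) (ht : t₀ ≤ t)
    (nη nα s nL : ℝ) (hnη : 1 < nη) (hnα : 1 < nα) (hs : 0 < s) (hnL : 1 < nL)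
    {N : ℕ} (𝔻 : Fin N → D) (h𝔻 : GPUCB.IsDiscretization a b r δ nL s t 𝔻)
    (η α : ℝ) (hη0 : 0 ≤ η) (hα0 : 0 ≤ α)
    (hη : GPUCB.piSeq t * nη * (1 - GPUCB.Phi √η) = 1)
    (hα : GPUCB.piSeq t * nα * N * (1 - GPUCB.Phi √α) = 1)
    (hαβ : α ≤ GPUCB.beta d a b r δ t) :
    GPUCB.HoldsWithProb μ (1 - δ / nL - 1 / GPUCB.piSeq t * (1 / nη + 1 / nα))
      (fun ω => GPUCB.regret f x t ω ≤
        (√(GPUCB.beta d a b r δ t) + √η) * GPUCB.sd k σ x t ω (x t ω)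
          - (√(GPUCB.beta d a b r δ t) - √α) * σ * √(1 / ((t : ℝ) + σ ^ 2))
          + 1 / (t : ℝ) ^ s) := by
  obtain ⟨n, rfl⟩ : ∃ n, t = n + 1 := ⟨t - 1, by omega⟩
  have hΩ : Nonempty Ω := nonempty_of_isProbabilityMeasure μ
  have hD : Nonempty D := hΩ.map (x 0)
  have hborel : StandardBorelSpace D := hset.isCompact.measurableSet.standardBorel
  obtain ⟨X, hX, hXx⟩ := hx.exists_strategy
  obtain ⟨A, hAm, hA0, hA⟩ := hset.exists_continuous_paths hb
  have hM := hset.isGaussianModel hσ hAm hA0 hA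
  have hk := hM.isUnitKernel
  obtain ⟨B, hBm, hB, hBp⟩ := hset.discretization_error ha hb hδ.1 (by omega) hnL h𝔻
  -- The sign `-1` gives the lower tail at the data-dependent point `x_t`; below, the sign `1` gives
  -- the upper tail at each `𝔻 j`.
  obtain ⟨hm1, hp1⟩ := hM.measure_adaptive_residual_gt hX (hX n) (s := -1) (by norm_num) √η
  have h2 := fun j => hM.measure_adaptive_residual_gt hX (n := n) (z := fun _ => 𝔻 j)
    measurable_const (s := 1) (by norm_num) √α
  have hY : Measurable fun ω => (contPath f A hA ω,
      obsPath X (contPath f A hA ω).1 n fun j => ε (j + 1) ω) :=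
    hM.model.measurable_path.prodMk ((measurable_obsPath hM.model.measurable_eval hX n).comp
      (hM.model.measurable_path.prodMk
        (measurable_pi_lambda _ fun j => hM.model.measurable_noise j)))
  set Z : Ω → {h : D → ℝ // Continuous h} × (Fin n → ℝ) := fun ω => (contPath f A hA ω,
      obsPath X (contPath f A hA ω).1 n fun j => ε (j + 1) ω) with hZ
  set R1 : Set ({h : D → ℝ // Continuous h} × (Fin n → ℝ)) := {q |
    √η * postStd k σ (designPts X n q.2) (X n q.2) <
      -1 * (q.1.1 (X n q.2) - postMean k σ (designPts X n q.2) q.2 (X n q.2))} with hR1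
  set R2 : Fin N → Set ({h : D → ℝ // Continuous h} × (Fin n → ℝ)) := fun j => {q |
    √α * postStd k σ (designPts X n q.2) (𝔻 j) <
      1 * (q.1.1 (𝔻 j) - postMean k σ (designPts X n q.2) q.2 (𝔻 j))} with hR2
  have hPhi : ∀ c, 0 ≤ 1 - Phi c := fun c => sub_nonneg.2 (cdf_le_one _ _)
  have hm2 : ∀ j, MeasurableSet (Z ⁻¹' R2 j) := fun j => hY (h2 j).1
  have hp1' : μ.real (Z ⁻¹' R1) = 1 - Phi √η := by
    have : μ (Z ⁻¹' R1) = ENNReal.ofReal (1 - Phi √η) := hp1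
    rw [Measure.real, this, ENNReal.toReal_ofReal (hPhi _)]
  have hp2' : ∀ j, μ.real (Z ⁻¹' R2 j) = 1 - Phi √α := fun j => by
    have : μ (Z ⁻¹' R2 j) = ENNReal.ofReal (1 - Phi √α) := (h2 j).2
    rw [Measure.real, this, ENNReal.toReal_ofReal (hPhi _)]
  set C : Set Ω := Aᶜ ∪ (Bᶜ ∪ (Z ⁻¹' R1 ∪ ⋃ j, Z ⁻¹' R2 j)) with hC
  have hCm : MeasurableSet C :=
    hAm.compl.union (hBm.compl.union ((hY hm1).union (.iUnion hm2)))
  refine ⟨Cᶜ, hCm.compl, fun ω hω => ?_, ?_⟩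
  · simp only [hC, Set.compl_union, compl_compl, Set.mem_inter_iff, Set.mem_compl_iff,
      Set.mem_iUnion, not_exists] at hω
    obtain ⟨hωA, hωB, hω1, hω2⟩ := hω
    have hpath : (contPath f A hA ω).1 = fun u => f u ω := by
      ext u
      simp [contPath, hωA]
    have hZω : Z ω = (contPath f A hA ω, pastObs f ε x (n + 1) ω) := by
      simp only [hZ, hpath, obsPath_eq_pastObs hXx]
    have hpts := pastPoints_eq_designPts hXx n ω
    have hlow : f (x (n + 1) ω) ω ≥ mu k σ f ε x (n + 1) ω (x (n + 1) ω) -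
        √η * sd k σ x (n + 1) ω (x (n + 1) ω) := by
      rw [Set.mem_preimage, hZω, hR1, Set.mem_ofPred_eq, hpath, ← hpts, ← hXx] at hω1
      simp only [mu, sd]
      linarith
    have hup : ∀ j, f (𝔻 j) ω ≤ mu k σ f ε x (n + 1) ω (𝔻 j) +
        √α * sd k σ x (n + 1) ω (𝔻 j) := fun j => by
      have h := hω2 j
      rw [Set.mem_preimage, hZω, hR2, Set.mem_ofPred_eq, hpath, ← hpts] at h
      simp only [mu, sd]
      linarith
    have hsd : ∀ z, σ * √(1 / (((n + 1 : ℕ) : ℝ) + σ ^ 2)) ≤ sd k σ x (n + 1) ω z := fun z => by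
      have h := hk.le_postVar hσ (pastPoints x (n + 1) ω) z
      have h1 : σ * √(1 / (((n + 1 : ℕ) : ℝ) + σ ^ 2)) =
          √(σ ^ 2 / (((n + 1 : ℕ) : ℝ) + σ ^ 2)) := by
        rw [div_eq_mul_one_div (σ ^ 2), Real.sqrt_mul (sq_nonneg σ), Real.sqrt_sq hσ.le]
      rw [h1]
      -- The posterior rests on `t - 1` observations, so its bound is weakened from `t - 1` to `t`
      -- in the denominator.
      refine Real.sqrt_le_sqrt (le_trans ?_ h)
      gcongr
      omega
    have hαβ' : √α ≤ √(beta d a b r δ (n + 1)) := Real.sqrt_le_sqrt hαβ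
    rw [regret, sub_le_iff_le_add]
    refine ciSup_le fun u => ?_
    obtain ⟨j, hj⟩ := hB ω hωB u
    have hmax := hx.maximizes (n + 1) ht ω (𝔻 j)
    simp only [ucb] at hmax
    -- Here `α ≤ β` is needed: the lower bound on `sd` at `𝔻 j` is multiplied by `√β - √α`.
    have h3 := mul_le_mul_of_nonneg_left (hsd (𝔻 j)) (sub_nonneg.2 hαβ')
    have h4 := hup j
    linarith
  · rw [probReal_compl_eq_one_sub hCm]
    have hpi : 0 < piSeq (n + 1) := by
      unfold piSeq
      positivity
    have hη' : 1 - Phi √η = 1 / piSeq (n + 1) * (1 / nη) := by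
      field_simp
      linarith
    have hα' : N * (1 - Phi √α) = 1 / piSeq (n + 1) * (1 / nα) := by
      field_simp
      linarith
    have hCle : μ.real C ≤ μ.real Aᶜ + (μ.real Bᶜ +
        (μ.real (Z ⁻¹' R1) + ∑ j, μ.real (Z ⁻¹' R2 j))) := by
      refine (measureReal_union_le _ _).trans (add_le_add_right ?_ _)
      refine (measureReal_union_le _ _).trans (add_le_add_right ?_ _)
      refine (measureReal_union_le _ _).trans (add_le_add_right ?_ _)
      exact measureReal_iUnion_fintype_le _
    rw [hp1', probReal_compl_eq_one_sub hBm, show μ.real Aᶜ = 0 by simp [Measure.real, hA0],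
      Finset.sum_congr rfl fun j _ => hp2' j, Finset.sum_const, Finset.card_univ, Fintype.card_fin,
      nsmul_eq_mul, hα', hη'] at hCle
    rw [mul_add]
    linarith
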